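/- Let $H^3$ be three-dimensional hyperbolic space with its canonical orientation. Let $S$ be a compact (connected, smoothly embedded) surface in $H^3$ that is quadratically convex: $S$ is strictly convex, i.e. for every $p\in S$ the complete totally geodesic surface tangent to $S$ at $p$ meets $S$ only at $p$, and the shape operator of $S$ is definite at every point. Let $\mathcal U$ be the set of oriented lines (oriented, unparametrized complete geodesics) of $H^3$ that do not meet $S$. For $\ell=[\gamma]\in\mathcal U$ there are exactly two complete totally geodesic surfaces $P_+,P_-$ that contain $\ell$ and are tangent to $S$, at points $p_+,p_-$ say. Let $q_\pm$ be the point of $\ell$ nearest to $p_\pm$, let $\gamma_\pm$ be the unit speed geodesic ray from $q_\pm$ through $p_\pm$, and let $W_\pm$ be the parallel vector field along $\gamma$ whose value at $q_\pm$ is $\gamma_\pm'(0)$; the labels are chosen so that $\{W_+,W_-,\gamma'\}$ is positively oriented. The outer billiard map $B:\mathcal U\to\mathcal U$ associated with $S$ sends $\ell$ to the oriented line obtained by parallel transporting $\ell$ along $\gamma_+$ from $\gamma_+(0)=q_+$ to $\gamma_+(2d)$, where $d$ is the distance from $q_+$ to $p_+$. If $\ell\in\mathcal U$ is a periodic point of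 $B$ of minimal period $n$, put $\ell_k=B^k(\ell)$ and let $d_k\in\mathbb R$ be the signed distance from $q_-(\ell_k)$ to $q_+(\ell_k)$, that is, $\gamma_k(d_k)=q_+(\ell_k)$ where $\ell_k=[\gamma_k]$, $\gamma_k$ has unit speed and $\gamma_k(0)=q_-(\ell_k)$. The holonomy of $B$ at $\ell$ is $\sum_{k=0}^{n-1}d_k$. There exist a quadratically convex compact surface $S$ in $H^3$ and an oriented line $\ell$ not meeting $S$ which is a periodic point of minimal period $4$ of the outer billiard map associated with $S$ and whose holonomy is not zero. -/

import Mathlib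

open scoped ContDiff

noncomputable section

namespace OuterBilliard

/-- The underlying vector space of Minkowski space of signature `(3, 1)`. -/
abbrev Mink : Type := Fin 4 → ℝ

/-- The Lorentz form `-x₀y₀ + x₁y₁ + x₂y₂ + x₃y₃`. -/
def lor (x y : Mink) : ℝ := -(x 0 * y 0) + x 1 * y 1 + x 2 * y 2 + x 3 * y 3

/-- Hyperbolic three-space (hyperboloid model). The tangent space at `x` is
`{v | lor x v = 0}` and the Riemannian metric is the restriction of `lor` to it. -/
def H3 : Set Mink := {x | lor x x = -1 ∧ 0 < x 0}

/-- The hyperbolic distance. -/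
def hdist (x y : Mink) : ℝ := Real.arcosh (-lor x y)

/-- The `lor`-orthogonal projection of an ambient vector onto the tangent space of `H3` at `x`. -/
def tanProj (x v : Mink) : Mink := v + lor x v • x

/-- The Levi-Civita covariant derivative of a vector field `X` along a curve `c` in `H3`:
the tangential part of the ordinary derivative. -/
def covDeriv (c X : ℝ → Mink) (t : ℝ) : Mink := tanProj (c t) (deriv X t)

/-- `X` is a smooth parallel tangent vector field along the curve `c` in `H3`. -/
def IsParallel (c X : ℝ → Mink) : Prop :=
  ContDiff ℝ ∞ X ∧ (∀ t, lor (c t) (X t) = 0) ∧ ∀ t, covDeriv c X t = 0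

/-- A frame `(u, v, w)` of the tangent space at `x ∈ H3` is positive for the canonical
orientation, in which the coordinate frame is positive at `(1, 0, 0, 0)`. -/
def PosFrame (x u v w : Mink) : Prop := 0 < (Matrix.of ![x, u, v, w]).det

/-- Complete unit speed geodesics of `H3`. -/
structure Geod where
  toFun : ℝ → Mink
  mem : ∀ t, toFun t ∈ H3
  smooth : ContDiff ℝ ∞ toFun
  unit_speed : ∀ t, lor (deriv toFun t) (deriv toFun t) = 1
  geodesic : ∀ t, covDeriv toFun (deriv toFun) t = 0

instance : CoeFun Geod (fun _ => ℝ → Mink) := ⟨Geod.toFun⟩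

/-- Two unit speed geodesics are equivalent if they differ by a shift of the parameter. -/
instance geodSetoid : Setoid Geod where
  r γ σ := ∃ t₀ : ℝ, ∀ t, σ t = γ (t + t₀)
  iseqv :=
    { refl := fun γ => ⟨0, fun t => by simp⟩
      symm := by
        rintro γ σ ⟨a, h⟩
        exact ⟨-a, fun t => by rw [h]; simp⟩
      trans := by
        rintro γ σ τ ⟨a, h⟩ ⟨b, k⟩
        exact ⟨b + a, fun t => by rw [k, h, add_assoc]⟩ }

/-- Oriented (unparametrized, complete) geodesics of `H3`. -/
abbrev OrLine : Type := Quotient geodSetoid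

/-- `γ` is a unit speed parametrization of the oriented line `ℓ`. -/
def Geod.Represents (γ : Geod) (ℓ : OrLine) : Prop := (Quotient.mk geodSetoid γ) = ℓ

/-- The set of points of an oriented line. -/
def OrLine.points (ℓ : OrLine) : Set Mink := {x | ∃ γ : Geod, γ.Represents ℓ ∧ ∃ t, γ t = x}

/-- A connected compact smooth embedded surface in `H3`, together with a smooth unit normal
field (which is unique up to sign; no choice between inward and outward is made).
The field `normal` matters only on `carrier`; it is extended smoothly to a neighbourhood. -/
structure CompactSurface where
  carrier : Set Mink
  normal : Mink → Mink
  subset_H3 : carrier ⊆ H3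
  isCompact : IsCompact carrier
  isConnected : IsConnected carrier
  /-- Near each of its points the surface is a regular level set in `H3`, and `normal` is
  orthogonal to it. -/
  regular : ∀ p ∈ carrier, ∃ U : Set Mink, IsOpen U ∧ p ∈ U ∧ ∃ f : Mink → ℝ,
    ContDiffOn ℝ ∞ f U ∧ carrier ∩ U = {x | x ∈ H3 ∧ x ∈ U ∧ f x = 0} ∧
    ∃ c : ℝ, c ≠ 0 ∧ ∀ v, lor p v = 0 → fderiv ℝ f p v = c * lor (normal p) v
  normal_smooth : ∃ U : Set Mink, IsOpen U ∧ carrier ⊆ U ∧ ContDiffOn ℝ ∞ normal U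
  normal_tangent : ∀ p ∈ carrier, lor p (normal p) = 0
  normal_unit : ∀ p ∈ carrier, lor (normal p) (normal p) = 1

namespace CompactSurface

variable (S : CompactSurface)

/-- The tangent space of the surface at one of its points. -/
def tangentSpace (p : Mink) : Set Mink := {v | lor p v = 0 ∧ lor (S.normal p) v = 0}

/-- The shape operator `x ↦ -∇ₓ n`. -/
def shape (p x : Mink) : Mink := -tanProj p (fderiv ℝ S.normal p x)

/-- The complete totally geodesic surface tangent to `S` at `p`: the section of the hyperboloid
by the linear hyperplane spanned by `p` and the tangent space of `S` at `p`. -/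
def tangentPlane (p : Mink) : Set Mink := {x | x ∈ H3 ∧ lor (S.normal p) x = 0}

/-- Each tangent plane meets the surface only at the point of tangency. -/
def StrictlyConvex : Prop := ∀ p ∈ S.carrier, S.tangentPlane p ∩ S.carrier = {p}

/-- A strictly convex surface whose shape operator is definite at every point. -/
def QuadraticallyConvex : Prop :=
  S.StrictlyConvex ∧ ∀ p ∈ S.carrier,
    (∀ x ∈ S.tangentSpace p, x ≠ 0 → 0 < lor (S.shape p x) x) ∨
    (∀ x ∈ S.tangentSpace p, x ≠ 0 → lor (S.shape p x) x < 0)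

/-- The billiard table: the oriented lines that do not meet the surface. -/
def Table : Type := {ℓ : OrLine // Disjoint ℓ.points S.carrier}

/-- The points of `S` at which the tangent plane contains the line `ℓ`. -/
def touchPoints (ℓ : OrLine) : Set Mink := {p | p ∈ S.carrier ∧ ℓ.points ⊆ S.tangentPlane p}

end CompactSurface

/-- `q` is a point of `ℓ` realizing the distance from `p` to `ℓ`. -/
def IsFoot (ℓ : OrLine) (p q : Mink) : Prop :=
  q ∈ ℓ.points ∧ ∀ x ∈ ℓ.points, hdist q p ≤ hdist x p

/-- `σ` is a unit speed geodesic that runs from `q` (time `0`) to `p` (time `hdist q p`). -/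
def Joins (σ : Geod) (q p : Mink) : Prop := σ 0 = q ∧ σ (hdist q p) = p

/-- The frame `{W₊, W₋, γ'}` along `ℓ = [γ]` is positively oriented, where `W₊`, `W₋` are the
parallel fields along `γ` that at `q₊`, `q₋` are the initial velocities of the unit speed
geodesics from `q₊` to `p₊` and from `q₋` to `p₋`. -/
def RightLeft (ℓ : OrLine) (pPlus pMinus qPlus qMinus : Mink) : Prop :=
  ∃ (γ σPlus σMinus : Geod) (tPlus tMinus : ℝ) (WPlus WMinus : ℝ → Mink),
    γ.Represents ℓ ∧ γ tPlus = qPlus ∧ γ tMinus = qMinus ∧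
    Joins σPlus qPlus pPlus ∧ Joins σMinus qMinus pMinus ∧
    IsParallel γ WPlus ∧ WPlus tPlus = deriv σPlus 0 ∧
    IsParallel γ WMinus ∧ WMinus tMinus = deriv σMinus 0 ∧
    ∀ t, PosFrame (γ t) (WPlus t) (WMinus t) (deriv γ t)

/-- `p₊, p₋` are the points of tangency of the (exactly two) tangent planes of `S` that contain
`ℓ`, labelled by the orientation of `ℓ`, and `q₊, q₋` are the points of `ℓ` nearest to them. -/
structure IsConfig (S : CompactSurface) (ℓ : OrLine) (pPlus pMinus qPlus qMinus : Mink) :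
    Prop where
  touch : S.touchPoints ℓ = {pPlus, pMinus}
  foot_plus : IsFoot ℓ pPlus qPlus
  foot_minus : IsFoot ℓ pMinus qMinus
  right_left : RightLeft ℓ pPlus pMinus qPlus qMinus

/-- `ℓ'` is obtained by parallel transporting `ℓ` along the geodesic `σ`, which starts on `ℓ`,
between times `0` and `s`. -/
def IsParallelTranslate (ℓ : OrLine) (σ : Geod) (s : ℝ) (ℓ' : OrLine) : Prop :=
  ∃ (γ γ' : Geod) (X : ℝ → Mink), γ.Represents ℓ ∧ γ'.Represents ℓ' ∧ IsParallel σ X ∧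
    γ 0 = σ 0 ∧ deriv γ 0 = X 0 ∧ γ' 0 = σ s ∧ deriv γ' 0 = X s

/-- The graph of the outer billiard map: `ℓ'` is the parallel transport of `ℓ` along the geodesic
ray from `q₊` through `p₊`, between `0` and twice the distance from `q₊` to `p₊`. -/
def IsImage (S : CompactSurface) (ℓ ℓ' : OrLine) : Prop :=
  ∃ (pPlus pMinus qPlus qMinus : Mink) (σ : Geod), IsConfig S ℓ pPlus pMinus qPlus qMinus ∧
    Joins σ qPlus pPlus ∧ IsParallelTranslate ℓ σ (2 * hdist qPlus pPlus) ℓ'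

open Classical in
/-- The outer billiard map `B` of the table of `S`. For a strictly convex compact surface the
line `ℓ'` always exists and is unique; otherwise the map is given the dummy value `ℓ`
(so that a point where the dummy value is used is a fixed point). -/
def outerBilliard (S : CompactSurface) (ℓ : S.Table) : S.Table :=
  if h : ∃! ℓ' : S.Table, IsImage S ℓ.1 ℓ'.1 then h.choose else ℓ

/-- `d` is the signed distance from `q₋` to `q₊` along `ℓ`: if `ℓ = [γ]` with `γ 0 = q₋`, then
`γ d = q₊`. -/
def IsSignedDist (S : CompactSurface) (ℓ : OrLine) (d : ℝ) : Prop :=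
  ∃ (pPlus pMinus qPlus qMinus : Mink) (γ : Geod), IsConfig S ℓ pPlus pMinus qPlus qMinus ∧
    γ.Represents ℓ ∧ γ 0 = qMinus ∧ γ d = qPlus

/-- `h` is the holonomy of the outer billiard map at its periodic point `ℓ`: the sum of the
signed distances from `q₋` to `q₊` over one period of the orbit. -/
def IsHolonomy (S : CompactSurface) (ℓ : S.Table) (h : ℝ) : Prop :=
  ℓ ∈ Function.periodicPts (outerBilliard S) ∧
  ∃ d : ℕ → ℝ,
    (∀ k < Function.minimalPeriod (outerBilliard S) ℓ,
      IsSignedDist S ((outerBilliard S)^[k] ℓ).1 (d k)) ∧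
    h = ∑ k ∈ Finset.range (Function.minimalPeriod (outerBilliard S) ℓ), d k

end OuterBilliard

end

/-!
In the Klein model geodesic planes are affine planes, so the zero set, inside the unit ball, of a
function with positive definite Hessian is a quadratically convex surface. The billiard map applies
to a line `ℓ` the geodesic symmetry at `p₊` and reverses the orientation of the image; the point
`p₊` of `ℓ` becomes the point `p₋` of the image. A periodic orbit is therefore a closed chain of
lines `ℓ k` and points `p k` of the surface, where `ℓ k` is tangent to the surface at `p k` and
`p (k + 1)`. We start from a chain of four lines that is invariant under the rotation by `π` about
an axis; tangency prescribes four points of the surface and the tangent planes there, and these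
conditions are met by a convex quartic. The signed distances along the chain are, alternately,
`-arsinh (495 / 952)` and `arsinh (33 / 56)`, so they do not cancel.
-/

noncomputable section

namespace OuterBilliard

/-! ### The Lorentz form -/

theorem lor_comm (x y : Mink) : lor x y = lor y x := by simp only [lor]; ring

theorem lor_add_left (x y z : Mink) : lor (x + y) z = lor x z + lor y z := by
  simp only [lor, Pi.add_apply]; ring

theorem lor_smul_left (a : ℝ) (x z : Mink) : lor (a • x) z = a * lor x z := by
  simp only [lor, Pi.smul_apply, smul_eq_mul]; ring

theorem lor_add_right (x y z : Mink) : lor x (y + z) = lor x y + lor x z := by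
  simp only [lor_comm x, lor_add_left]

theorem lor_smul_right (a : ℝ) (x z : Mink) : lor x (a • z) = a * lor x z := by
  simp only [lor_comm x, lor_smul_left]

/-- The Lorentz form as a continuous bilinear map. -/
def lorL : Mink →L[ℝ] Mink →L[ℝ] ℝ :=
  (LinearMap.mk₂ ℝ lor lor_add_left lor_smul_left lor_add_right
    lor_smul_right).toContinuousBilinearMap

theorem lor_neg_left (x z : Mink) : lor (-x) z = -lor x z := lorL.map_neg₂ x z

theorem lor_sub_left (x y z : Mink) : lor (x - y) z = lor x z - lor y z := lorL.map_sub₂ x y z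

theorem lor_sub_right (x y z : Mink) : lor x (y - z) = lor x y - lor x z := map_sub (lorL x) y z

theorem lor_zero_left (x : Mink) : lor 0 x = 0 := lorL.map_zero₂ x

theorem lor_zero_right (x : Mink) : lor x 0 = 0 := map_zero (lorL x)

theorem hasDerivAt_lor {f g : ℝ → Mink} {f' g' : Mink} {t : ℝ} (hf : HasDerivAt f f' t)
    (hg : HasDerivAt g g' t) :
    HasDerivAt (fun s => lor (f s) (g s)) (lor (f t) g' + lor f' (g t)) t :=
  lorL.hasDerivAt_of_bilinear (fun _ => hf) (fun _ => hg)

theorem lor_fderiv_left {N : Mink → Mink} {p : Mink} (hN : DifferentiableAt ℝ N p) (v w : Mink) :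
    lor (fderiv ℝ N p v) w = fderiv ℝ (fun x => lor (N x) w) p v := by
  have h : HasFDerivAt (fun x => lor (N x) w) ((lorL.flip w).comp (fderiv ℝ N p)) p :=
    (lorL.flip w).hasFDerivAt.comp p hN.hasFDerivAt
  rw [h.fderiv]
  rfl

theorem sq_lor_add_le (x y : Mink) :
    (lor x y + x 0 * y 0) ^ 2 ≤ (lor x x + x 0 ^ 2) * (lor y y + y 0 ^ 2) := by
  simp only [lor]
  linarith [sq_nonneg (x 1 * y 2 - x 2 * y 1), sq_nonneg (x 1 * y 3 - x 3 * y 1),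
    sq_nonneg (x 2 * y 3 - x 3 * y 2)]

theorem one_le_sq_time {p : Mink} (hp : lor p p = -1) : 1 ≤ p 0 ^ 2 := by
  simp only [lor] at hp
  nlinarith [sq_nonneg (p 1), sq_nonneg (p 2), sq_nonneg (p 3)]

theorem lor_self_pos_of_time_eq_zero {v : Mink} (h0 : v 0 = 0) (hv : v ≠ 0) : 0 < lor v v := by
  have hspace : lor v v = v 1 ^ 2 + v 2 ^ 2 + v 3 ^ 2 := by simp only [lor, h0]; ring
  by_contra! hle
  have h1 : v 1 = 0 := by nlinarith [sq_nonneg (v 1), sq_nonneg (v 2), sq_nonneg (v 3)]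
  have h2 : v 2 = 0 := by nlinarith [sq_nonneg (v 1), sq_nonneg (v 2), sq_nonneg (v 3)]
  have h3 : v 3 = 0 := by nlinarith [sq_nonneg (v 1), sq_nonneg (v 2), sq_nonneg (v 3)]
  exact hv (by ext i; fin_cases i <;> assumption)

theorem lor_self_pos {p v : Mink} (hp : lor p p = -1) (h : lor p v = 0) (hv : v ≠ 0) :
    0 < lor v v := by
  have hcs := sq_lor_add_le p v
  rw [hp, h] at hcs
  by_contra! hle
  have h0 : v 0 ^ 2 ≤ 0 := by nlinarith [one_le_sq_time hp]
  exact hle.not_gt (lor_self_pos_of_time_eq_zero (by nlinarith) hv)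

theorem abs_time_lt {q w : Mink} (hq : q ∈ H3) (h : lor q w = 0) (hw : lor w w = 1) :
    |w 0| < q 0 := by
  have hcs := sq_lor_add_le q w
  rw [hq.1, h, hw] at hcs
  exact abs_lt_of_sq_lt_sq (by linarith) hq.2.le

theorem lor_lt_zero {p q : Mink} (hp : p ∈ H3) (hq : q ∈ H3) : lor p q < 0 := by
  have hcs := sq_lor_add_le p q
  rw [hp.1, hq.1] at hcs
  have hpq : 0 < p 0 * q 0 := mul_pos hp.2 hq.2
  by_contra! hle
  nlinarith [one_le_sq_time hp.1, one_le_sq_time hq.1, mul_nonneg hle hpq.le]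

theorem one_lt_neg_lor {p q : Mink} (hp : p ∈ H3) (hq : q ∈ H3) (h : p ≠ q) :
    1 < -lor p q := by
  have hneg := lor_lt_zero hp hq
  have hself : lor (q + lor p q • p) (q + lor p q • p) = lor p q ^ 2 - 1 := by
    simp only [lor_add_left, lor_add_right, lor_smul_left, lor_smul_right, hp.1, hq.1,
      lor_comm q p]
    ring
  have hpos : 0 < lor p q ^ 2 - 1 := by
    rw [← hself]
    refine lor_self_pos hp.1 (by rw [lor_add_right, lor_smul_right, hp.1]; ring) fun h0 => h ?_
    rw [h0, lor_zero_left] at hself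
    have hone : lor p q = -1 := by nlinarith
    simpa [hone, add_neg_eq_zero, eq_comm] using h0
  nlinarith

/-! ### Geodesics and parallel fields -/

/-- The curve `t ↦ cosh t q + sinh t w`, the geodesic with initial data `(q, w)` when `w` is a unit
tangent vector at `q`. Its velocity is `hyperbola w q`. -/
def hyperbola (q w : Mink) (t : ℝ) : Mink := Real.cosh t • q + Real.sinh t • w

theorem hyperbola_zero (q w : Mink) : hyperbola q w 0 = q := by simp [hyperbola]

theorem hasDerivAt_hyperbola (q w : Mink) (t : ℝ) :
    HasDerivAt (hyperbola q w) (hyperbola w q t) t := by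
  rw [hyperbola, add_comm]
  exact ((Real.hasDerivAt_cosh t).smul_const q).add ((Real.hasDerivAt_sinh t).smul_const w)

theorem hyperbola_add (q w : Mink) (s t : ℝ) :
    hyperbola q w (s + t) = hyperbola (hyperbola q w s) (hyperbola w q s) t := by
  simp only [hyperbola, Real.cosh_add, Real.sinh_add]
  module

theorem hyperbola_smul (a : ℝ) (q w : Mink) (t : ℝ) :
    hyperbola (a • q) (a • w) t = a • hyperbola q w t := by
  simp only [hyperbola]
  module

theorem lor_hyperbola_left (q w : Mink) (t : ℝ) (v : Mink) :
    lor (hyperbola q w t) v = Real.cosh t * lor q v + Real.sinh t * lor w v := by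
  simp only [hyperbola, lor_add_left, lor_smul_left]

theorem lor_hyperbola_right (v q w : Mink) (t : ℝ) :
    lor v (hyperbola q w t) = Real.cosh t * lor v q + Real.sinh t * lor v w := by
  simp only [lor_comm v, lor_hyperbola_left]

/-- A point of `H3` with a unit tangent vector at it. -/
structure UnitTangent (q w : Mink) : Prop where
  mem : q ∈ H3
  orth : lor q w = 0
  unit : lor w w = 1

namespace UnitTangent

variable {q w : Mink}

theorem hyperbola_time_pos (h : UnitTangent q w) (t : ℝ) : 0 < hyperbola q w t 0 := by
  have hsinh : |Real.sinh t| < Real.cosh t :=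
    abs_lt_of_sq_lt_sq (by linarith [Real.cosh_sq t]) (Real.cosh_pos t).le
  have hlt : |Real.sinh t * w 0| < Real.cosh t * q 0 := by
    rw [abs_mul]
    exact mul_lt_mul'' hsinh (abs_time_lt h.mem h.orth h.unit) (abs_nonneg _) (abs_nonneg _)
  simp only [hyperbola, Pi.add_apply, Pi.smul_apply, smul_eq_mul]
  linarith [(abs_lt.1 hlt).1]

theorem at_time (h : UnitTangent q w) (t : ℝ) :
    UnitTangent (hyperbola q w t) (hyperbola w q t) := by
  refine ⟨⟨?_, h.hyperbola_time_pos t⟩, ?_, ?_⟩ <;>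
    simp only [lor_hyperbola_left, lor_hyperbola_right, h.mem.1, h.orth, h.unit, lor_comm w q]
  · linear_combination -Real.cosh_sq t
  · ring
  · linear_combination Real.cosh_sq t

/-- The geodesic with given initial data. -/
def geod (h : UnitTangent q w) : Geod where
  toFun := hyperbola q w
  mem t := (h.at_time t).mem
  smooth := (Real.contDiff_cosh.smul contDiff_const).add (Real.contDiff_sinh.smul contDiff_const)
  unit_speed t := by
    rw [(hasDerivAt_hyperbola q w t).deriv]
    exact (h.at_time t).unit
  geodesic t := by
    have hderiv : deriv (hyperbola q w) = hyperbola w q :=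
      funext fun s => (hasDerivAt_hyperbola q w s).deriv
    rw [hderiv, covDeriv, tanProj, (hasDerivAt_hyperbola w q t).deriv, (h.at_time t).mem.1,
      neg_one_smul, add_neg_cancel]

theorem geod_apply (h : UnitTangent q w) (t : ℝ) : h.geod t = hyperbola q w t := rfl

theorem deriv_geod (h : UnitTangent q w) (t : ℝ) : deriv h.geod t = hyperbola w q t :=
  (hasDerivAt_hyperbola q w t).deriv

end UnitTangent

theorem lor_add_lor_eq_zero_of_const {f g : ℝ → Mink} {f' g' : Mink} {t a : ℝ}
    (hf : HasDerivAt f f' t) (hg : HasDerivAt g g' t) (h : ∀ s, lor (f s) (g s) = a) :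
    lor (f t) g' + lor f' (g t) = 0 := by
  have hconst := hasDerivAt_lor hf hg
  simp only [h] at hconst
  exact hconst.unique (hasDerivAt_const t a)

theorem deriv_eq_smul_of_covDeriv_eq_zero {c X : ℝ → Mink} {t : ℝ} (hc : DifferentiableAt ℝ c t)
    (hX : DifferentiableAt ℝ X t) (htan : ∀ s, lor (c s) (X s) = 0) (hcov : covDeriv c X t = 0) :
    deriv X t = lor (deriv c t) (X t) • c t := by
  have hsum := lor_add_lor_eq_zero_of_const hc.hasDerivAt hX.hasDerivAt htan
  rw [eq_neg_of_add_eq_zero_left hcov, ← neg_smul, eq_neg_of_add_eq_zero_left hsum, neg_neg]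

namespace Geod

variable (γ : Geod)

theorem hasDerivAt (t : ℝ) : HasDerivAt γ (deriv γ t) t :=
  ((γ.smooth.differentiable (by simp)) t).hasDerivAt

theorem unitTangent (t : ℝ) : UnitTangent (γ t) (deriv γ t) := by
  have h := lor_add_lor_eq_zero_of_const (γ.hasDerivAt t) (γ.hasDerivAt t) fun s => (γ.mem s).1
  rw [lor_comm (deriv γ t)] at h
  exact ⟨γ.mem t, by linarith, γ.unit_speed t⟩

theorem hasDerivAt_deriv (t : ℝ) : HasDerivAt (deriv γ) (γ t) t := by
  have hdiff : DifferentiableAt ℝ (deriv γ) t :=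
    (contDiff_infty_iff_deriv.1 γ.smooth).2.differentiable (by simp) t
  have h := deriv_eq_smul_of_covDeriv_eq_zero (γ.hasDerivAt t).differentiableAt hdiff
    (fun s => (γ.unitTangent s).orth) (γ.geodesic t)
  rw [γ.unit_speed t, one_smul] at h
  exact h ▸ hdiff.hasDerivAt

theorem eq_hyperbola (t : ℝ) : γ t = hyperbola (γ 0) (deriv γ 0) t := by
  have hpos (s : ℝ) : HasDerivAt (fun s => Real.cosh s • γ s - Real.sinh s • deriv γ s) 0 s :=
    (((Real.hasDerivAt_cosh s).smul (γ.hasDerivAt s)).sub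
      ((Real.hasDerivAt_sinh s).smul (γ.hasDerivAt_deriv s))).congr_deriv (by module)
  have hvel (s : ℝ) : HasDerivAt (fun s => Real.cosh s • deriv γ s - Real.sinh s • γ s) 0 s :=
    (((Real.hasDerivAt_cosh s).smul (γ.hasDerivAt_deriv s)).sub
      ((Real.hasDerivAt_sinh s).smul (γ.hasDerivAt s))).congr_deriv (by module)
  have hpos0 := is_const_of_deriv_eq_zero (fun s => (hpos s).differentiableAt)
    (fun s => (hpos s).deriv) t 0
  have hvel0 := is_const_of_deriv_eq_zero (fun s => (hvel s).differentiableAt)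
    (fun s => (hvel s).deriv) t 0
  simp only [Real.cosh_zero, Real.sinh_zero, one_smul, zero_smul, sub_zero] at hpos0 hvel0
  calc γ t = (Real.cosh t ^ 2 - Real.sinh t ^ 2) • γ t := by rw [Real.cosh_sq_sub_sinh_sq, one_smul]
    _ = Real.cosh t • (Real.cosh t • γ t - Real.sinh t • deriv γ t) +
        Real.sinh t • (Real.cosh t • deriv γ t - Real.sinh t • γ t) := by module
    _ = hyperbola (γ 0) (deriv γ 0) t := by rw [hpos0, hvel0, hyperbola]

@[ext] theorem ext {γ σ : Geod} (h : ∀ t, γ t = σ t) : γ = σ := by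
  cases γ
  cases σ
  simp only [mk.injEq]
  exact funext h

theorem eq_geod {q w : Mink} (h : UnitTangent q w) (h0 : γ 0 = q) (h1 : deriv γ 0 = w) :
    γ = h.geod := by
  ext t : 1
  rw [γ.eq_hyperbola, h0, h1, h.geod_apply]

end Geod

namespace UnitTangent

variable {q w : Mink}

/-- The oriented line with given initial data. -/
def line (h : UnitTangent q w) : OrLine := Quotient.mk geodSetoid h.geod

theorem geod_at_time_apply (h : UnitTangent q w) (s t : ℝ) :
    (h.at_time s).geod t = h.geod (s + t) := (hyperbola_add q w s t).symm

theorem represents_iff (h : UnitTangent q w) (γ : Geod) :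
    γ.Represents h.line ↔ ∃ s, γ = (h.at_time s).geod := by
  rw [Geod.Represents, line, Quotient.eq]
  constructor
  · rintro ⟨s, hs⟩
    refine ⟨-s, Geod.ext fun t => ?_⟩
    rw [h.geod_at_time_apply, hs, neg_add_cancel_comm]
  · rintro ⟨s, rfl⟩
    refine ⟨-s, fun t => ?_⟩
    rw [h.geod_at_time_apply, add_neg_cancel_comm_assoc]

theorem line_at_time (h : UnitTangent q w) (s : ℝ) : (h.at_time s).line = h.line :=
  (h.represents_iff _).2 ⟨s, rfl⟩

theorem line_points (h : UnitTangent q w) : h.line.points = Set.range (hyperbola q w) := by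
  ext x
  constructor
  · rintro ⟨γ, hγ, t, rfl⟩
    obtain ⟨s, rfl⟩ := (h.represents_iff γ).1 hγ
    exact ⟨s + t, hyperbola_add q w s t⟩
  · rintro ⟨t, rfl⟩
    exact ⟨h.geod, rfl, t, rfl⟩

end UnitTangent

theorem UnitTangent.isParallel_const {q w v : Mink} (h : UnitTangent q w) (hq : lor q v = 0)
    (hw : lor w v = 0) : IsParallel h.geod fun _ => v where
  left := contDiff_const
  right.left t := by rw [h.geod_apply, lor_hyperbola_left, hq, hw, mul_zero, mul_zero, add_zero]
  right.right t := by rw [covDeriv, deriv_const, tanProj, lor_zero_right, zero_smul, add_zero]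

theorem IsParallel.eq_const {γ : Geod} {X : ℝ → Mink} (hX : IsParallel γ X) {t₀ : ℝ}
    (h : lor (deriv γ t₀) (X t₀) = 0) (t : ℝ) : X t = X t₀ := by
  obtain ⟨hsmooth, htan, hcov⟩ := hX
  have hdiff : Differentiable ℝ X := hsmooth.differentiable (by simp)
  have hderiv (t : ℝ) : deriv X t = lor (deriv γ t) (X t) • γ t :=
    deriv_eq_smul_of_covDeriv_eq_zero (γ.hasDerivAt t).differentiableAt (hdiff t) htan (hcov t)
  have hangle (t : ℝ) : HasDerivAt (fun t => lor (deriv γ t) (X t)) 0 t := by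
    refine (hasDerivAt_lor (γ.hasDerivAt_deriv t) (hdiff t).hasDerivAt).congr_deriv ?_
    rw [htan, hderiv, lor_smul_right, lor_comm (deriv γ t) (γ t), (γ.unitTangent t).orth,
      mul_zero, add_zero]
  have horth (t : ℝ) : lor (deriv γ t) (X t) = 0 := by
    rw [← h]
    exact is_const_of_deriv_eq_zero (fun s => (hangle s).differentiableAt)
      (fun s => (hangle s).deriv) t t₀
  exact is_const_of_deriv_eq_zero hdiff (fun s => by rw [hderiv, horth, zero_smul]) t t₀

/-! ### Distances, feet and joining geodesics -/

section Distance

variable {p q : Mink} (hq : q ∈ H3) (hp : p ∈ H3)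

include hq hp

theorem one_le_neg_lor : 1 ≤ -lor q p := by
  obtain rfl | h := eq_or_ne q p
  · rw [hq.1, neg_neg]
  · exact (one_lt_neg_lor hq hp h).le

theorem cosh_hdist : Real.cosh (hdist q p) = -lor q p :=
  Real.cosh_arcosh (one_le_neg_lor hq hp)

theorem sinh_hdist_pos (hne : q ≠ p) : 0 < Real.sinh (hdist q p) :=
  Real.sinh_pos_iff.2 (Real.arcosh_pos (one_lt_neg_lor hq hp hne))

end Distance

theorem UnitTangent.isFoot_iff {q w : Mink} (h : UnitTangent q w) {p : Mink} (hp : p ∈ H3)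
    {t : ℝ} (ht : lor (hyperbola w q t) p = 0) (x : Mink) :
    IsFoot h.line p x ↔ x = hyperbola q w t := by
  have hlor (s : ℝ) : -lor (hyperbola q w s) p = Real.cosh (s - t) * -lor (hyperbola q w t) p := by
    rw [← add_sub_cancel t s, hyperbola_add, lor_hyperbola_left, ht, add_sub_cancel]
    ring
  have hneg (s : ℝ) : lor (hyperbola q w s) p < 0 := lor_lt_zero (h.at_time s).mem hp
  have hle (s s' : ℝ) : hdist (hyperbola q w s) p ≤ hdist (hyperbola q w s') p ↔
      |s - t| ≤ |s' - t| := by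
    rw [hdist, hdist, Real.arcosh_le_arcosh (neg_pos.2 (hneg s)) (neg_pos.2 (hneg s')), hlor s,
      hlor s', mul_le_mul_iff_left₀ (neg_pos.2 (hneg t)), Real.cosh_le_cosh]
  rw [IsFoot, h.line_points]
  constructor
  · rintro ⟨⟨s, rfl⟩, hs⟩
    have := (hle s t).1 (hs _ ⟨t, rfl⟩)
    rw [sub_self, abs_zero, abs_nonpos_iff, sub_eq_zero] at this
    rw [this]
  · rintro rfl
    refine ⟨⟨t, rfl⟩, Set.forall_mem_range.2 fun s => (hle t s).2 ?_⟩
    rw [sub_self, abs_zero]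
    exact abs_nonneg _

/-- The initial velocity at `q` of the unit speed geodesic from `q` to `p`. -/
def dirTo (q p : Mink) : Mink :=
  (Real.sinh (hdist q p))⁻¹ • (p - Real.cosh (hdist q p) • q)

section Joining

variable {p q : Mink} (hq : q ∈ H3) (hp : p ∈ H3) (hne : q ≠ p)

include hq hp hne

theorem unitTangent_dirTo : UnitTangent q (dirTo q p) := by
  have hsinh := (sinh_hdist_pos hq hp hne).ne'
  have hlor : lor q p = -Real.cosh (hdist q p) := by rw [cosh_hdist hq hp, neg_neg]
  refine ⟨hq, ?_, ?_⟩
  · rw [dirTo, lor_smul_right, lor_sub_right, lor_smul_right, hq.1, hlor]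
    ring
  · simp only [dirTo, lor_smul_left, lor_smul_right, lor_sub_left, lor_sub_right, hq.1, hp.1,
      lor_comm p q, hlor]
    field_simp
    linear_combination Real.cosh_sq (hdist q p)

theorem hyperbola_dirTo : hyperbola q (dirTo q p) (hdist q p) = p := by
  rw [hyperbola, dirTo, smul_inv_smul₀ (sinh_hdist_pos hq hp hne).ne', add_sub_cancel]

theorem joins_iff (σ : Geod) : Joins σ q p ↔ σ = (unitTangent_dirTo hq hp hne).geod := by
  constructor
  · rintro ⟨h0, h1⟩
    refine σ.eq_geod _ h0 ?_
    rw [σ.eq_hyperbola, h0, hyperbola] at h1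
    rw [dirTo, eq_inv_smul_iff₀ (sinh_hdist_pos hq hp hne).ne', eq_sub_iff_add_eq', h1]
  · rintro rfl
    exact ⟨hyperbola_zero _ _, hyperbola_dirTo hq hp hne⟩

end Joining

/-- The geodesic symmetry of `H3` at `p`, extended linearly to Minkowski space. -/
def reflect (p x : Mink) : Mink := -x - (2 * lor x p) • p

theorem reflect_smul (a : ℝ) (p x : Mink) : reflect p (a • x) = a • reflect p x := by
  rw [reflect, reflect, lor_smul_left]
  module

theorem hyperbola_dirTo_two_mul {q p : Mink} (hq : q ∈ H3) (hp : p ∈ H3) (hne : q ≠ p) :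
    hyperbola q (dirTo q p) (2 * hdist q p) = reflect p q := by
  have hlor : lor q p = -Real.cosh (hdist q p) := by rw [cosh_hdist hq hp, neg_neg]
  have hdir : Real.sinh (hdist q p) • dirTo q p = p - Real.cosh (hdist q p) • q :=
    smul_inv_smul₀ (sinh_hdist_pos hq hp hne).ne' _
  rw [hyperbola, Real.sinh_two_mul, mul_right_comm, mul_smul, hdir, Real.cosh_two_mul,
    Real.sinh_sq, reflect, hlor]
  module

/-! ### Lines tangent to a supported surface -/

theorem lor_hyperbola_eq_zero_iff {q e v : Mink} (t : ℝ) :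
    lor (hyperbola q e t) v = 0 ∧ lor (hyperbola e q t) v = 0 ↔ lor q v = 0 ∧ lor e v = 0 := by
  constructor
  · rintro ⟨hq, he⟩
    rw [lor_hyperbola_left] at hq he
    constructor
    · linear_combination Real.cosh t * hq - Real.sinh t * he -
        lor q v * Real.cosh_sq_sub_sinh_sq t
    · linear_combination Real.cosh t * he - Real.sinh t * hq -
        lor e v * Real.cosh_sq_sub_sinh_sq t
  · rintro ⟨hq, he⟩
    simp only [lor_hyperbola_left, hq, he, mul_zero, add_zero, and_self]

theorem lor_dirTo_eq_zero {q e p : Mink} (hq : lor q e = 0) (hp : lor e p = 0) :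
    lor (dirTo q p) e = 0 := by
  rw [dirTo, lor_smul_left, lor_sub_left, lor_smul_left, hq, lor_comm p, hp, mul_zero, sub_zero,
    mul_zero]

namespace UnitTangent

variable {q e : Mink}

theorem hyperbola_injective (h : UnitTangent q e) : Function.Injective (hyperbola q e) := by
  have hlor (t : ℝ) : lor (hyperbola q e t) e = Real.sinh t := by
    rw [lor_hyperbola_left, h.orth, h.unit, mul_zero, zero_add, mul_one]
  exact fun s t hst => Real.sinh_injective (by rw [← hlor, ← hlor, hst])

theorem card_le_two_of_linearIndependent (h : UnitTangent q e) {ι : Type*} [Fintype ι]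
    {v : ι → Mink} (hv : LinearIndependent ℝ v) (hq : ∀ i, lor q (v i) = 0)
    (he : ∀ i, lor e (v i) = 0) : Fintype.card ι ≤ 2 := by
  let f : Mink →ₗ[ℝ] ℝ × ℝ := (lorL q).toLinearMap.prod (lorL e).toLinearMap
  have hf (x : Mink) : f x = (lor q x, lor e x) := rfl
  have hsurj : LinearMap.range f = ⊤ := by
    refine LinearMap.range_eq_top.2 fun y => ⟨-y.1 • q + y.2 • e, ?_⟩
    rw [hf]
    simp only [lor_add_right, lor_smul_right, h.mem.1, h.orth, h.unit, lor_comm e q]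
    ext <;> ring
  have hker : Module.finrank ℝ (LinearMap.ker f) = 2 := by
    have hrank := f.finrank_range_add_finrank_ker
    rw [hsurj, finrank_top, Module.finrank_prod, Module.finrank_self, Module.finrank_fin_fun]
      at hrank
    omega
  have hmem (i : ι) : v i ∈ LinearMap.ker f := by
    rw [LinearMap.mem_ker, hf, hq, he, Prod.mk_zero_zero]
  have hv' : LinearIndependent ℝ fun i => (⟨v i, hmem i⟩ : LinearMap.ker f) :=
    LinearIndependent.of_comp (LinearMap.ker f).subtype hv
  exact hv'.fintype_card_le_finrank.trans_eq hker

theorem mem_touchPoints_iff (h : UnitTangent q e) (S : CompactSurface) (c : Mink) :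
    c ∈ S.touchPoints h.line ↔
      c ∈ S.carrier ∧ lor q (S.normal c) = 0 ∧ lor e (S.normal c) = 0 := by
  have hrange : h.line.points ⊆ S.tangentPlane c ↔ ∀ t, lor (hyperbola q e t) (S.normal c) = 0 := by
    simp only [h.line_points, Set.range_subset_iff, lor_comm _ (S.normal c)]
    exact forall_congr' fun t => and_iff_right (h.at_time t).mem
  refine and_congr_right fun _ => hrange.trans ⟨fun ht => ?_, fun ht t => ?_⟩
  · have h0 := ht 0
    have h1 := ht 1
    rw [hyperbola_zero] at h0
    rw [lor_hyperbola_left, h0, mul_zero, zero_add] at h1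
    exact ⟨h0, (mul_eq_zero.1 h1).resolve_left (Real.sinh_pos_iff.2 one_pos).ne'⟩
  · exact ((lor_hyperbola_eq_zero_iff t).2 ht).1

end UnitTangent

namespace CompactSurface

variable {S : CompactSurface}

/-- The surface lies strictly on the negative side of each of its tangent planes, apart from the
point of tangency. -/
def Supported (S : CompactSurface) : Prop :=
  ∀ p ∈ S.carrier, ∀ x ∈ S.carrier, x ≠ p → lor (S.normal p) x < 0

namespace Supported

theorem strictlyConvex (hS : S.Supported) : S.StrictlyConvex := by
  intro p hp
  ext x
  constructor
  · rintro ⟨⟨-, h0⟩, hx⟩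
    by_contra hne
    exact (hS p hp x hx hne).ne h0
  · rintro rfl
    exact ⟨⟨S.subset_H3 hp, by rw [lor_comm, S.normal_tangent x hp]⟩, hp⟩

theorem disjoint_points (hS : S.Supported) {ℓ : OrLine} {a b : Mink} (ha : a ∈ S.touchPoints ℓ)
    (hb : b ∈ S.touchPoints ℓ) (hne : a ≠ b) : Disjoint ℓ.points S.carrier := by
  refine Set.disjoint_left.2 fun x hxℓ hxS => hne ?_
  have heq {c : Mink} (hc : c ∈ S.touchPoints ℓ) : x = c := by
    by_contra h
    exact (hS c hc.1 x hxS h).ne (hc.2 hxℓ).2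
  rw [← heq ha, ← heq hb]

theorem linearIndependent_normal (hS : S.Supported) {p : Fin 3 → Mink}
    (hp : ∀ i, p i ∈ S.carrier) (hinj : Function.Injective p) :
    LinearIndependent ℝ fun i => S.normal (p i) := by
  let M : Matrix (Fin 3) (Fin 3) ℝ := Matrix.of fun i j => lor (S.normal (p i)) (p j)
  have hdiag (i : Fin 3) : M i i = 0 := (lor_comm _ _).trans (S.normal_tangent _ (hp i))
  have hneg {i j : Fin 3} (hij : j ≠ i) : M i j < 0 :=
    hS _ (hp i) _ (hp j) (hinj.ne hij)
  have hdet : M.det < 0 := by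
    have hcycle := mul_pos_of_neg_of_neg (hneg (i := 0) (j := 1) (by decide))
      (hneg (i := 1) (j := 2) (by decide))
    have hcycle' := mul_pos_of_neg_of_neg (hneg (i := 0) (j := 2) (by decide))
      (hneg (i := 1) (j := 0) (by decide))
    rw [Matrix.det_fin_three]
    simp only [hdiag]
    nlinarith [mul_neg_of_pos_of_neg hcycle (hneg (i := 2) (j := 0) (by decide)),
      mul_neg_of_pos_of_neg hcycle' (hneg (i := 2) (j := 1) (by decide))]
  refine Fintype.linearIndependent_iff.2 fun g hg => congrFun
    (Matrix.eq_zero_of_vecMul_eq_zero hdet.ne (funext fun j => ?_))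
  have hlor := congrArg (fun x => lorL x (p j)) hg
  rw [map_sum, map_zero, sum_apply, zero_apply] at hlor
  simp only [map_smul, smul_apply] at hlor
  exact hlor

theorem touchPoints_eq (hS : S.Supported) {q e a b : Mink} (h : UnitTangent q e)
    (ha : a ∈ S.touchPoints h.line) (hb : b ∈ S.touchPoints h.line) (hne : a ≠ b) :
    S.touchPoints h.line = {a, b} := by
  refine Set.Subset.antisymm (fun c hc => ?_) (Set.pair_subset ha hb)
  by_contra hcab
  simp only [Set.mem_insert_iff, Set.mem_singleton_iff, not_or] at hcab
  have hall : ∀ i : Fin 3, ![a, b, c] i ∈ S.touchPoints h.line := by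
    simp only [Fin.forall_fin_succ, Fin.forall_fin_zero]
    exact ⟨ha, hb, hc, trivial⟩
  have hinj : Function.Injective ![a, b, c] := by
    simp only [Matrix.vecCons, Fin.cons_injective_iff]
    simp [hne, Ne.symm hcab.1, Ne.symm hcab.2, Function.injective_of_subsingleton]
  have hindep := hS.linearIndependent_normal (fun i => (hall i).1) hinj
  have hcard := h.card_le_two_of_linearIndependent hindep
    (fun i => ((h.mem_touchPoints_iff S _).1 (hall i)).2.1)
    (fun i => ((h.mem_touchPoints_iff S _).1 (hall i)).2.2)
  norm_num at hcard

end Supported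

end CompactSurface

/-! ### The billiard map on a line with given points of tangency -/

theorem frame_det (x u v w : Mink) : (Matrix.of ![x, u, v, w]).det =
    (x 0 * u 1 - x 1 * u 0) * (v 2 * w 3 - v 3 * w 2)
    - (x 0 * u 2 - x 2 * u 0) * (v 1 * w 3 - v 3 * w 1)
    + (x 0 * u 3 - x 3 * u 0) * (v 1 * w 2 - v 2 * w 1)
    + (x 1 * u 2 - x 2 * u 1) * (v 0 * w 3 - v 3 * w 0)
    - (x 1 * u 3 - x 3 * u 1) * (v 0 * w 2 - v 2 * w 0)
    + (x 2 * u 3 - x 3 * u 2) * (v 0 * w 1 - v 1 * w 0) := by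
  simp [Matrix.det_succ_row_zero, Fin.sum_univ_succ, Fin.succAbove]
  ring

theorem PosFrame.not_swap {x u v w : Mink} (h : PosFrame x u v w) : ¬ PosFrame x v u w := by
  rw [PosFrame, frame_det] at *
  linarith

theorem posFrame_hyperbola_iff {q e u v : Mink} (t : ℝ) :
    PosFrame (hyperbola q e t) u v (hyperbola e q t) ↔ PosFrame q u v e := by
  have hdet : (Matrix.of ![hyperbola q e t, u, v, hyperbola e q t]).det =
      (Real.cosh t ^ 2 - Real.sinh t ^ 2) * (Matrix.of ![q, u, v, e]).det := by
    simp only [frame_det, hyperbola, Pi.add_apply, Pi.smul_apply, smul_eq_mul]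
    ring
  rw [PosFrame, PosFrame, hdet, Real.cosh_sq_sub_sinh_sq, one_mul]

theorem PosFrame.dirTo_dirTo {q e a b : Mink} (h : PosFrame q a b e) {t : ℝ}
    (ha : 0 < Real.sinh (hdist (hyperbola q e t) a)) (hb : 0 < Real.sinh (hdist q b)) :
    PosFrame q (dirTo (hyperbola q e t) a) (dirTo q b) e := by
  have hdet (r s r' s' : ℝ) :
      (Matrix.of ![q, r • (a - s • hyperbola q e t), r' • (b - s' • q), e]).det =
        r * r' * (Matrix.of ![q, a, b, e]).det := by
    simp only [frame_det, hyperbola, Pi.add_apply, Pi.sub_apply, Pi.smul_apply, smul_eq_mul]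
    ring
  rw [PosFrame, dirTo, dirTo, hdet]
  exact mul_pos (mul_pos (inv_pos.2 ha) (inv_pos.2 hb)) h

/-- The geodesic with initial data `(q, e)` lies in the planes tangent to `S` at `a` and `b`, the
points of the geodesic nearest to `a` and `b` have parameters `d` and `0`, and the orientation
makes `a` the point `p₊` and `b` the point `p₋`. -/
structure TangencyData (S : CompactSurface) (q e : Mink) (d : ℝ) (a b : Mink) : Prop where
  unitTangent : UnitTangent q e
  right_mem : a ∈ S.touchPoints unitTangent.line
  left_mem : b ∈ S.touchPoints unitTangent.line
  right_foot : lor (hyperbola e q d) a = 0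
  left_foot : lor e b = 0
  frame : PosFrame q a b e

namespace TangencyData

variable {S : CompactSurface} {q e a b : Mink} {d : ℝ}

theorem right_mem_H3 (T : TangencyData S q e d a b) : a ∈ H3 := S.subset_H3 T.right_mem.1

theorem left_mem_H3 (T : TangencyData S q e d a b) : b ∈ H3 := S.subset_H3 T.left_mem.1

theorem isFoot_right (T : TangencyData S q e d a b) (x : Mink) :
    IsFoot T.unitTangent.line a x ↔ x = hyperbola q e d :=
  T.unitTangent.isFoot_iff T.right_mem_H3 T.right_foot x

theorem isFoot_left (T : TangencyData S q e d a b) (x : Mink) :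
    IsFoot T.unitTangent.line b x ↔ x = q := by
  have h := T.unitTangent.isFoot_iff T.left_mem_H3 (t := 0)
    (by rw [hyperbola_zero, T.left_foot]) x
  rwa [hyperbola_zero] at h

theorem lor_right_dir (T : TangencyData S q e d a b) :
    lor (dirTo (hyperbola q e d) a) (hyperbola e q d) = 0 :=
  lor_dirTo_eq_zero (T.unitTangent.at_time d).orth T.right_foot

theorem lor_left_dir (T : TangencyData S q e d a b) : lor (dirTo q b) e = 0 :=
  lor_dirTo_eq_zero T.unitTangent.orth T.left_foot

theorem ne (T : TangencyData S q e d a b) : a ≠ b := by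
  rintro rfl
  exact T.frame.not_swap T.frame

variable (T : TangencyData S q e d a b) (hS : S.Supported)

include hS

theorem disjoint : Disjoint T.unitTangent.line.points S.carrier :=
  hS.disjoint_points T.right_mem T.left_mem T.ne

include T

theorem hyperbola_ne {c : Mink} (hc : c ∈ S.carrier) (t : ℝ) : hyperbola q e t ≠ c := by
  rintro rfl
  refine Set.disjoint_left.1 (T.disjoint hS) ?_ hc
  rw [T.unitTangent.line_points]
  exact Set.mem_range_self t

theorem base_ne {c : Mink} (hc : c ∈ S.carrier) : q ≠ c :=
  hyperbola_zero q e ▸ T.hyperbola_ne hS hc 0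

theorem unitTangent_right_dir :
    UnitTangent (hyperbola q e d) (dirTo (hyperbola q e d) a) :=
  unitTangent_dirTo (T.unitTangent.at_time d).mem T.right_mem_H3 (T.hyperbola_ne hS T.right_mem.1 d)

theorem unitTangent_left_dir : UnitTangent q (dirTo q b) :=
  unitTangent_dirTo T.unitTangent.mem T.left_mem_H3 (T.base_ne hS T.left_mem.1)

theorem joins_right_iff (σ : Geod) :
    Joins σ (hyperbola q e d) a ↔ σ = (T.unitTangent_right_dir hS).geod :=
  joins_iff (T.unitTangent.at_time d).mem T.right_mem_H3 (T.hyperbola_ne hS T.right_mem.1 d) σ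

theorem joins_left_iff (σ : Geod) : Joins σ q b ↔ σ = (T.unitTangent_left_dir hS).geod :=
  joins_iff T.unitTangent.mem T.left_mem_H3 (T.base_ne hS T.left_mem.1) σ

theorem posFrame_dir : PosFrame q (dirTo (hyperbola q e d) a) (dirTo q b) e :=
  T.frame.dirTo_dirTo
    (sinh_hdist_pos (T.unitTangent.at_time d).mem T.right_mem_H3
      (T.hyperbola_ne hS T.right_mem.1 d))
    (sinh_hdist_pos T.unitTangent.mem T.left_mem_H3 (T.base_ne hS T.left_mem.1))

theorem rightLeft : RightLeft T.unitTangent.line a b (hyperbola q e d) q := by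
  have hright := T.unitTangent_right_dir hS
  have hleft := T.unitTangent_left_dir hS
  obtain ⟨horth, horth'⟩ := (lor_hyperbola_eq_zero_iff d).1
    ⟨hright.orth, (lor_comm _ _).trans T.lor_right_dir⟩
  refine ⟨T.unitTangent.geod, hright.geod, hleft.geod, d, 0, fun _ => dirTo (hyperbola q e d) a,
    fun _ => dirTo q b, rfl, rfl, hyperbola_zero _ _, (T.joins_right_iff hS _).2 rfl,
    (T.joins_left_iff hS _).2 rfl, T.unitTangent.isParallel_const horth horth', ?_,
    T.unitTangent.isParallel_const hleft.orth ((lor_comm _ _).trans T.lor_left_dir), ?_,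
    fun t => ?_⟩
  · rw [hright.deriv_geod, hyperbola_zero]
  · rw [hleft.deriv_geod, hyperbola_zero]
  · rw [UnitTangent.deriv_geod, UnitTangent.geod_apply, posFrame_hyperbola_iff]
    exact T.posFrame_dir hS

theorem not_rightLeft_swap : ¬ RightLeft T.unitTangent.line b a q (hyperbola q e d) := by
  rintro ⟨γ, σ, τ, s, t, V, W, hγ, hs, ht, hσ, hτ, hV, hVs, hW, hWt, hpos⟩
  obtain ⟨u, rfl⟩ := (T.unitTangent.represents_iff γ).1 hγ
  obtain rfl := (T.joins_left_iff hS σ).1 hσ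
  obtain rfl := (T.joins_right_iff hS τ).1 hτ
  rw [UnitTangent.deriv_geod, hyperbola_zero] at hVs hWt
  rw [UnitTangent.geod_apply, ← hyperbola_add] at hs ht
  have hs' : u + s = 0 := T.unitTangent.hyperbola_injective (by rw [hs, hyperbola_zero])
  have ht' : u + t = d := T.unitTangent.hyperbola_injective ht
  have hVconst := hV.eq_const (t₀ := s) (by
    rw [UnitTangent.deriv_geod, ← hyperbola_add, hs', hyperbola_zero, hVs, lor_comm,
      T.lor_left_dir])
  have hWconst := hW.eq_const (t₀ := t) (by
    rw [UnitTangent.deriv_geod, ← hyperbola_add, ht', hWt, lor_comm, T.lor_right_dir])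
  have hframe := hpos s
  rw [hVconst, hWconst, hVs, hWt, UnitTangent.deriv_geod, UnitTangent.geod_apply,
    posFrame_hyperbola_iff, posFrame_hyperbola_iff] at hframe
  exact hframe.not_swap (T.posFrame_dir hS)

theorem isConfig : IsConfig S T.unitTangent.line a b (hyperbola q e d) q where
  touch := hS.touchPoints_eq T.unitTangent T.right_mem T.left_mem T.ne
  foot_plus := (T.isFoot_right _).2 rfl
  foot_minus := (T.isFoot_left _).2 rfl
  right_left := T.rightLeft hS

theorem config_unique {a' b' x y : Mink} (h : IsConfig S T.unitTangent.line a' b' x y) :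
    a' = a ∧ b' = b ∧ x = hyperbola q e d ∧ y = q := by
  have ht := h.touch
  rw [(T.isConfig hS).touch, Set.pair_eq_pair_iff] at ht
  rcases ht with ⟨rfl, rfl⟩ | ⟨rfl, rfl⟩
  · exact ⟨rfl, rfl, (T.isFoot_right _).1 h.foot_plus, (T.isFoot_left _).1 h.foot_minus⟩
  · obtain rfl := (T.isFoot_left _).1 h.foot_plus
    obtain rfl := (T.isFoot_right _).1 h.foot_minus
    exact absurd h.right_left (T.not_rightLeft_swap hS)

theorem hyperbola_right_dir :
    hyperbola (hyperbola q e d) (dirTo (hyperbola q e d) a) (2 * hdist (hyperbola q e d) a) =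
      reflect a (hyperbola q e d) :=
  hyperbola_dirTo_two_mul (T.unitTangent.at_time d).mem T.right_mem_H3
    (T.hyperbola_ne hS T.right_mem.1 d)

theorem isImage (h' : UnitTangent (reflect a (hyperbola q e d)) (hyperbola e q d)) :
    IsImage S T.unitTangent.line h'.line := by
  have hright := T.unitTangent_right_dir hS
  refine ⟨a, b, hyperbola q e d, q, hright.geod, T.isConfig hS, (T.joins_right_iff hS _).2 rfl,
    (T.unitTangent.at_time d).geod, h'.geod, fun _ => hyperbola e q d,
    T.unitTangent.line_at_time d, rfl,
    hright.isParallel_const (T.unitTangent.at_time d).orth T.lor_right_dir, ?_, ?_, ?_, ?_⟩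
  · simp only [UnitTangent.geod_apply, hyperbola_zero]
  · rw [UnitTangent.deriv_geod, hyperbola_zero]
  · rw [h'.geod_apply, hyperbola_zero, hright.geod_apply, T.hyperbola_right_dir hS]
  · rw [h'.deriv_geod, hyperbola_zero]

theorem eq_line_of_isImage {ℓ : OrLine} (h : IsImage S T.unitTangent.line ℓ)
    (h' : UnitTangent (reflect a (hyperbola q e d)) (hyperbola e q d)) : ℓ = h'.line := by
  obtain ⟨a', b', x, y, σ, hconfig, hσ, γ, γ', X, hγ, hγ', hX, hγ0, hdγ0, hγ'0, hdγ'0⟩ := h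
  obtain ⟨rfl, rfl, rfl, rfl⟩ := T.config_unique hS hconfig
  obtain rfl := (T.joins_right_iff hS σ).1 hσ
  obtain ⟨s, rfl⟩ := (T.unitTangent.represents_iff γ).1 hγ
  rw [UnitTangent.geod_apply, UnitTangent.geod_apply, hyperbola_zero, hyperbola_zero] at hγ0
  obtain rfl := T.unitTangent.hyperbola_injective hγ0
  rw [UnitTangent.deriv_geod, hyperbola_zero] at hdγ0
  have hXconst := hX.eq_const (t₀ := 0) (by
    rw [UnitTangent.deriv_geod, hyperbola_zero, ← hdγ0, T.lor_right_dir])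
  rw [hXconst, ← hdγ0] at hdγ'0
  rw [UnitTangent.geod_apply, T.hyperbola_right_dir hS] at hγ'0
  rw [← hγ', γ'.eq_geod h' hγ'0 hdγ'0]
  rfl

omit T in
/-- The oriented line of tangency data as an element of the billiard table. -/
def table (T : TangencyData S q e d a b) (hS : S.Supported) : S.Table :=
  ⟨T.unitTangent.line, T.disjoint hS⟩

theorem outerBilliard_table {q' e' a' : Mink} {d' : ℝ} (T' : TangencyData S q' e' d' a' a)
    (hq' : q' = reflect a (hyperbola q e d)) (he' : e' = hyperbola e q d) :
    outerBilliard S (T.table hS) = T'.table hS := by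
  subst hq' he'
  have himage : IsImage S (T.table hS).1 (T'.table hS).1 := T.isImage hS T'.unitTangent
  have hunique (ℓ : S.Table) (h : IsImage S (T.table hS).1 ℓ.1) : ℓ = T'.table hS :=
    Subtype.ext (T.eq_line_of_isImage hS h T'.unitTangent)
  have hex : ∃! ℓ : S.Table, IsImage S (T.table hS).1 ℓ.1 := ⟨T'.table hS, himage, hunique⟩
  rw [outerBilliard, dif_pos hex]
  exact hunique _ hex.choose_spec.1

theorem isSignedDist : IsSignedDist S (T.table hS).1 d :=
  ⟨a, b, hyperbola q e d, q, T.unitTangent.geod, T.isConfig hS, rfl, hyperbola_zero _ _, rfl⟩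

end TangencyData

/-! ### Closed chains of tangent lines -/

/-- A closed chain of `n` geodesics with initial data `(q k, e k)` and points `p k` of `S`: the
`k`-th geodesic is tangent to `S` towards `p k`, which is its `p₋` and is nearest to its point
`q k`; moved by `d k` and then translated through `p (k + 1)`, it becomes the next one. -/
structure PeriodicChain (S : CompactSurface) {n : ℕ} (q e p : ZMod n → Mink) (d : ZMod n → ℝ) :
    Prop where
  unitTangent : ∀ k, UnitTangent (q k) (e k)
  mem : ∀ k, p k ∈ S.touchPoints (unitTangent k).line
  foot : ∀ k, lor (e k) (p k) = 0
  frame : ∀ k, PosFrame (q k) (p (k + 1)) (p k) (e k)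
  base_succ : ∀ k, q (k + 1) = reflect (p (k + 1)) (hyperbola (q k) (e k) (d k))
  vel_succ : ∀ k, e (k + 1) = hyperbola (e k) (q k) (d k)

namespace PeriodicChain

variable {S : CompactSurface} {n : ℕ} {q e p : ZMod n → Mink} {d : ZMod n → ℝ}

theorem succ_mem_touchPoints (C : PeriodicChain S q e p d) (k : ZMod n) :
    p (k + 1) ∈ S.touchPoints (C.unitTangent k).line := by
  obtain ⟨hp, hq, he⟩ := ((C.unitTangent (k + 1)).mem_touchPoints_iff S _).1 (C.mem (k + 1))
  refine ((C.unitTangent k).mem_touchPoints_iff S _).2 ⟨hp, ?_⟩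
  rw [C.vel_succ] at he
  rw [C.base_succ, reflect, lor_sub_left, lor_smul_left, S.normal_tangent _ hp, mul_zero, sub_zero,
    lor_neg_left, neg_eq_zero] at hq
  exact (lor_hyperbola_eq_zero_iff (d k)).1 ⟨hq, he⟩

theorem tangencyData (C : PeriodicChain S q e p d) (k : ZMod n) :
    TangencyData S (q k) (e k) (d k) (p (k + 1)) (p k) where
  unitTangent := C.unitTangent k
  right_mem := C.succ_mem_touchPoints k
  left_mem := C.mem k
  right_foot := by rw [← C.vel_succ, C.foot]
  left_foot := C.foot k
  frame := C.frame k

/-- The lines of the chain as elements of the billiard table. -/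
def table (C : PeriodicChain S q e p d) (hS : S.Supported) (k : ZMod n) : S.Table :=
  (C.tangencyData k).table hS

theorem iterate_table_zero (C : PeriodicChain S q e p d) (hS : S.Supported) (m : ℕ) :
    (outerBilliard S)^[m] (C.table hS 0) = C.table hS m := by
  induction m with
  | zero => rw [Function.iterate_zero_apply, Nat.cast_zero]
  | succ m ih =>
    rw [Function.iterate_succ_apply', ih, Nat.cast_succ]
    exact (C.tangencyData m).outerBilliard_table hS (C.tangencyData (m + 1)) (C.base_succ m)
      (C.vel_succ m)

theorem table_injective (C : PeriodicChain S q e p d) (hS : S.Supported)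
    (hp : Function.Injective p) : Function.Injective (C.table hS) := by
  intro k l hkl
  have hconfig := (C.tangencyData l).isConfig hS
  rw [← show (C.unitTangent k).line = (C.unitTangent l).line from congrArg Subtype.val hkl]
    at hconfig
  exact (hp ((C.tangencyData k).config_unique hS hconfig).2.1).symm

theorem minimalPeriod_table_zero (C : PeriodicChain S q e p d) (hS : S.Supported)
    (hp : Function.Injective p) :
    Function.minimalPeriod (outerBilliard S) (C.table hS 0) = n := by
  have hperiodic (m : ℕ) : Function.IsPeriodicPt (outerBilliard S) m (C.table hS 0) ↔ n ∣ m := by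
    rw [Function.IsPeriodicPt, Function.IsFixedPt, C.iterate_table_zero hS,
      (C.table_injective hS hp).eq_iff, ZMod.natCast_eq_zero_iff]
  exact Nat.dvd_antisymm (((hperiodic n).2 dvd_rfl).minimalPeriod_dvd)
    ((hperiodic _).1 (Function.isPeriodicPt_minimalPeriod _ _))

theorem isHolonomy [NeZero n] (C : PeriodicChain S q e p d) (hS : S.Supported)
    (hp : Function.Injective p) : IsHolonomy S (C.table hS 0) (∑ k, d k) := by
  have hperiod := C.minimalPeriod_table_zero hS hp
  refine ⟨Function.minimalPeriod_pos_iff_mem_periodicPts.1 (by rw [hperiod]; exact NeZero.pos n),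
    fun m => d m, fun m _ => ?_, ?_⟩
  · rw [C.iterate_table_zero hS]
    exact (C.tangencyData m).isSignedDist hS
  · rw [hperiod]
    exact Finset.sum_nbij' ZMod.val (fun m => (m : ZMod n))
      (fun k _ => Finset.mem_range.2 (ZMod.val_lt k)) (fun m _ => Finset.mem_univ _)
      (fun k _ => ZMod.natCast_zmod_val k)
      (fun m hm => ZMod.val_natCast_of_lt (Finset.mem_range.1 hm))
      (fun k _ => by rw [ZMod.natCast_zmod_val])

end PeriodicChain

/-! ### Level sets of functions with positive definite Hessian -/

section PosDefHessian

variable {E : Type*} [NormedAddCommGroup E] [NormedSpace ℝ E] {f : E → ℝ}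

/-- The second derivative of `f` is a positive definite form at every point. -/
def PosDefHessian (f : E → ℝ) : Prop :=
  ∀ x v, v ≠ 0 → 0 < fderiv ℝ (fderiv ℝ f) x v v

namespace PosDefHessian

theorem fderiv_sub_lt (hH : PosDefHessian f) (hf : ContDiff ℝ 2 f) {x y : E} (hne : y ≠ x) :
    fderiv ℝ f x (y - x) < f y - f x := by
  have hline (t : ℝ) : HasDerivAt (fun s => x + s • (y - x)) (y - x) t := by
    simpa using ((hasDerivAt_id t).smul_const (y - x)).const_add x
  have hf' : Differentiable ℝ f := hf.differentiable (by simp)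
  have hf'' : Differentiable ℝ (fderiv ℝ f) :=
    (hf.fderiv_right (m := 1) (by norm_num)).differentiable (by simp)
  let φ' (t : ℝ) : ℝ := fderiv ℝ f (x + t • (y - x)) (y - x)
  have hφ (t : ℝ) : HasDerivAt (fun s => f (x + s • (y - x))) (φ' t) t :=
    (hf' _).hasFDerivAt.comp_hasDerivAt t (hline t)
  have hφ' (t : ℝ) : HasDerivAt φ' (fderiv ℝ (fderiv ℝ f) (x + t • (y - x)) (y - x) (y - x)) t :=
    ((ContinuousLinearMap.apply ℝ ℝ (y - x)).hasFDerivAt.comp _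
      (hf'' _).hasFDerivAt).comp_hasDerivAt t (hline t)
  have hmono : StrictMono φ' :=
    strictMono_of_hasDerivAt_pos hφ' fun t => hH _ _ (sub_ne_zero.2 hne)
  obtain ⟨c, hc, hslope⟩ := exists_hasDerivAt_eq_slope _ φ' zero_lt_one
    (continuous_iff_continuousAt.2 fun t => (hφ t).continuousAt).continuousOn fun t _ => hφ t
  have hlt := hmono hc.1
  rw [hslope] at hlt
  simpa [φ'] using hlt

theorem convexOn (hH : PosDefHessian f) (hf : ContDiff ℝ 2 f) : ConvexOn ℝ Set.univ f := by
  refine ⟨convex_univ, fun x _ y _ a b ha hb hab => ?_⟩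
  set z := a • x + b • y with hz
  have hle (w : E) : fderiv ℝ f z (w - z) ≤ f w - f z := by
    rcases eq_or_ne w z with rfl | hw
    · rw [sub_self, map_zero, sub_self]
    · exact (hH.fderiv_sub_lt hf hw).le
  have hzero : a * fderiv ℝ f z (x - z) + b * fderiv ℝ f z (y - z) = 0 := by
    have hsum : a • (x - z) + b • (y - z) = 0 := by
      rw [smul_sub, smul_sub, sub_add_sub_comm, ← hz, ← add_smul, hab, one_smul, sub_self]
    rw [← smul_eq_mul, ← smul_eq_mul, ← map_smul, ← map_smul, ← map_add, hsum, map_zero]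
  have hfz : f z = a * f z + b * f z := by rw [← add_mul, hab, one_mul]
  simp only [smul_eq_mul]
  linarith [mul_le_mul_of_nonneg_left (hle x) ha, mul_le_mul_of_nonneg_left (hle y) hb]

theorem frontier_sublevel (hH : PosDefHessian f) (hf : ContDiff ℝ 2 f) (hneg : ∃ y, f y < 0) :
    frontier {x | f x ≤ 0} = {x | f x = 0} := by
  refine (frontier_le_subset_eq hf.continuous continuous_const).antisymm fun x hx => ?_
  refine ⟨subset_closure (le_of_eq hx), fun hinterior => ?_⟩
  have hmax : IsLocalMax f x := by
    filter_upwards [mem_interior_iff_mem_nhds.1 hinterior] with y hy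
    exact hy.trans_eq (Eq.symm hx)
  obtain ⟨y, hy⟩ := hneg
  have hx : f x = 0 := hx
  have hlt := hH.fderiv_sub_lt hf (x := x) (y := y) (by rintro rfl; exact hy.ne hx)
  rw [hmax.fderiv_eq_zero, zero_apply, hx, sub_zero] at hlt
  exact hlt.not_gt hy

end PosDefHessian

theorem isConnected_frontier_of_convex {s : Set E} (hrank : 1 < Module.rank ℝ E)
    (hconv : Convex ℝ s) (hinterior : (interior s).Nonempty) (hbdd : Bornology.IsBounded s) :
    IsConnected (frontier s) := by
  obtain ⟨h, -, -, hfrontier⟩ :=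
    exists_homeomorph_image_interior_closure_frontier_eq_unitBall hconv hinterior hbdd
  rw [← h.toEquiv.symm_image_image (frontier s), h.coe_toEquiv, hfrontier]
  exact (isConnected_sphere hrank 0 zero_le_one).image _ h.symm.continuous.continuousOn

theorem PosDefHessian.isConnected_level (hH : PosDefHessian f) (hf : ContDiff ℝ 2 f)
    (hneg : ∃ y, f y < 0) (hrank : 1 < Module.rank ℝ E)
    (hbdd : Bornology.IsBounded {x | f x ≤ 0}) : IsConnected {x | f x = 0} := by
  rw [← hH.frontier_sublevel hf hneg]
  refine isConnected_frontier_of_convex hrank ?_ ?_ hbdd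
  · simpa using (hH.convexOn hf).convex_le 0
  · obtain ⟨y, hy⟩ := hneg
    exact ⟨y, interior_maximal (fun x hx => le_of_lt hx)
      (isOpen_lt hf.continuous continuous_const) hy⟩

end PosDefHessian

/-! ### Convex surfaces in the Klein model -/

theorem lor_eq_dotProduct (x y : Mink) : lor x y = -(x 0 * y 0) + Fin.tail x ⬝ᵥ Fin.tail y := by
  rw [dotProduct, Fin.sum_univ_three]
  change lor x y = -(x 0 * y 0) + (x 1 * y 1 + x 2 * y 2 + x 3 * y 3)
  rw [lor]
  ring

/-- The point of the Klein model, the open unit ball, that represents a point of `H3`. -/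
def klein (x : Mink) : Fin 3 → ℝ := (x 0)⁻¹ • Fin.tail x

/-- The point of `H3` represented by a point of the Klein model. -/
def fromKlein (y : Fin 3 → ℝ) : Mink := (√(1 - y ⬝ᵥ y))⁻¹ • Matrix.vecCons 1 y

theorem klein_smul_vecCons {a : ℝ} (ha : a ≠ 0) (y : Fin 3 → ℝ) :
    klein (a • Matrix.vecCons 1 y) = y := by
  ext i
  simp [klein, ha]

theorem smul_vecCons_klein {x : Mink} (hx : x 0 ≠ 0) : x 0 • Matrix.vecCons 1 (klein x) = x := by
  ext i
  cases i using Fin.cases with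
  | zero => simp
  | succ i => simp [klein, Fin.tail, hx]

theorem lor_vecCons_self (y : Fin 3 → ℝ) :
    lor (Matrix.vecCons 1 y) (Matrix.vecCons 1 y) = -(1 - y ⬝ᵥ y) := by
  rw [lor_eq_dotProduct]
  change -(1 * 1) + y ⬝ᵥ y = _
  ring

theorem klein_fromKlein {y : Fin 3 → ℝ} (hy : y ⬝ᵥ y < 1) : klein (fromKlein y) = y :=
  klein_smul_vecCons (inv_pos.2 (Real.sqrt_pos.2 (sub_pos.2 hy))).ne' y

theorem fromKlein_mem_H3 {y : Fin 3 → ℝ} (hy : y ⬝ᵥ y < 1) : fromKlein y ∈ H3 := by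
  have hpos := sub_pos.2 hy
  constructor
  · rw [fromKlein, lor_smul_left, lor_smul_right, lor_vecCons_self, ← mul_assoc, ← mul_inv,
      Real.mul_self_sqrt hpos.le, mul_neg, inv_mul_cancel₀ hpos.ne']
  · simpa [fromKlein] using hy

theorem fromKlein_klein {x : Mink} (hx : x ∈ H3) : fromKlein (klein x) = x := by
  have hx0 := hx.2
  have hlor := hx.1
  rw [← smul_vecCons_klein hx0.ne', lor_smul_left, lor_smul_right, lor_vecCons_self] at hlor
  have hsq : 1 - klein x ⬝ᵥ klein x = (x 0)⁻¹ ^ 2 := by field_simp; linear_combination -hlor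
  rw [fromKlein, hsq, Real.sqrt_sq (inv_pos.2 hx0).le, inv_inv, smul_vecCons_klein hx0.ne']

theorem continuousOn_fromKlein : ContinuousOn fromKlein {y | y ⬝ᵥ y < 1} := by
  have hdot : Continuous fun y : Fin 3 → ℝ => √(1 - y ⬝ᵥ y) := by fun_prop
  exact (hdot.continuousOn.inv₀ fun y hy => (Real.sqrt_pos.2 (sub_pos.2 hy)).ne').smul
    (continuous_const.matrixVecCons continuous_id).continuousOn

/-- The derivative of `klein` at a point over `y`, up to the scale factor of that point. -/
def kleinDeriv (y : Fin 3 → ℝ) : Mink →L[ℝ] (Fin 3 → ℝ) :=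
  ContinuousLinearMap.pi fun i =>
    ContinuousLinearMap.proj i.succ - y i • ContinuousLinearMap.proj 0

theorem kleinDeriv_apply (y : Fin 3 → ℝ) (v : Mink) : kleinDeriv y v = Fin.tail v - v 0 • y := by
  ext i
  simp [kleinDeriv, Fin.tail, mul_comm]

theorem hasFDerivAt_klein {x : Mink} (hx : x 0 ≠ 0) :
    HasFDerivAt klein ((x 0)⁻¹ • kleinDeriv (klein x)) x := by
  have htail : HasFDerivAt (fun z : Mink => Fin.tail z) (kleinDeriv 0) x :=
    (kleinDeriv 0).hasFDerivAt.congr_of_eventuallyEq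
      (.of_forall fun z => by rw [kleinDeriv_apply, smul_zero, sub_zero])
  have hinv := (hasDerivAt_inv hx).comp_hasFDerivAt x
    (ContinuousLinearMap.proj (R := ℝ) (φ := fun _ : Fin 4 => ℝ) 0).hasFDerivAt
  refine (hinv.smul htail).congr_fderiv (ContinuousLinearMap.ext fun v => ?_)
  ext i
  change (x 0)⁻¹ * (v i.succ - 0 * v 0) + -(x 0 ^ 2)⁻¹ * v 0 * x i.succ =
    (x 0)⁻¹ * (v i.succ - (x 0)⁻¹ * x i.succ * v 0)
  field_simp
  ring

theorem contDiffAt_klein {x : Mink} (hx : x 0 ≠ 0) : ContDiffAt ℝ ∞ klein x := by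
  have htime : ContDiffAt ℝ ∞ (fun z : Mink => z 0) x := by fun_prop
  have htail : ContDiffAt ℝ ∞ (fun z : Mink => Fin.tail z) x := by unfold Fin.tail; fun_prop
  exact (htime.inv hx).smul htail

theorem kleinDeriv_klein {x p : Mink} (hx : x 0 ≠ 0) :
    kleinDeriv (klein p) x = x 0 • (klein x - klein p) := by
  rw [kleinDeriv_apply, smul_sub, show x 0 • klein x = Fin.tail x from smul_inv_smul₀ hx _]

theorem eq_smul_vecCons_of_kleinDeriv_eq_zero {y : Fin 3 → ℝ} {v : Mink}
    (h : kleinDeriv y v = 0) : v = v 0 • Matrix.vecCons 1 y := by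
  rw [kleinDeriv_apply, sub_eq_zero] at h
  ext i
  cases i using Fin.cases with
  | zero => simp
  | succ i => simpa [Fin.tail] using congrFun h i

theorem kleinDeriv_ne_zero {p v : Mink} (hp : p ∈ H3) (hpv : lor p v = 0) (hv : v ≠ 0) :
    kleinDeriv (klein p) v ≠ 0 := by
  intro h
  have hspan := eq_smul_vecCons_of_kleinDeriv_eq_zero h
  have hcomm : p 0 • v = v 0 • p := by
    rw [← smul_vecCons_klein (x := p) hp.2.ne', smul_comm, smul_vecCons_klein hp.2.ne', ← hspan]
  have hlor := congrArg (lor p) hcomm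
  rw [lor_smul_right, lor_smul_right, hpv, hp.1] at hlor
  have hv0 : v 0 = 0 := by linarith
  rw [hspan, hv0, zero_smul] at hv
  exact hv rfl

/-- The Lorentz normal, not yet of unit length, at `x` of the level set of `f ∘ klein`. -/
def conormal (f : (Fin 3 → ℝ) → ℝ) (x : Mink) : Mink :=
  Matrix.vecCons (fderiv ℝ f (klein x) (klein x)) fun i =>
    fderiv ℝ f (klein x) (Pi.single i 1)

theorem lor_conormal (f : (Fin 3 → ℝ) → ℝ) (x v : Mink) :
    lor (conormal f x) v = fderiv ℝ f (klein x) (kleinDeriv (klein x) v) := by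
  set L := fderiv ℝ f (klein x)
  have hsum : L (Fin.tail v) = (fun i => L (Pi.single i 1)) ⬝ᵥ Fin.tail v := by
    conv_lhs => rw [pi_eq_sum_univ' (Fin.tail v), map_sum]
    exact Finset.sum_congr rfl fun i _ => by rw [map_smul, smul_eq_mul, mul_comm]
  rw [lor_eq_dotProduct, kleinDeriv_apply, map_sub, map_smul, smul_eq_mul, hsum, mul_comm (v 0)]
  exact neg_add_eq_sub _ _

theorem lor_self_conormal (f : (Fin 3 → ℝ) → ℝ) {x : Mink} (hx : x 0 ≠ 0) :
    lor x (conormal f x) = 0 := by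
  rw [lor_comm, lor_conormal, kleinDeriv_klein hx, sub_self, smul_zero, map_zero]

/-- A function whose nonpositive set is a convex body inside the Klein model. -/
structure KleinBody (f : (Fin 3 → ℝ) → ℝ) : Prop where
  contDiff : ContDiff ℝ ∞ f
  posDefHessian : PosDefHessian f
  exists_neg : ∃ y, f y < 0
  dotProduct_lt_one : ∀ y, f y ≤ 0 → y ⬝ᵥ y < 1

namespace KleinBody

variable {f : (Fin 3 → ℝ) → ℝ}

theorem contDiff_two (hf : KleinBody f) : ContDiff ℝ 2 f := contDiff_infty.1 hf.contDiff 2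

theorem isBounded (hf : KleinBody f) : Bornology.IsBounded {y | f y ≤ 0} := by
  refine (Metric.isBounded_closedBall (x := (0 : Fin 3 → ℝ)) (r := 1)).subset fun y hy => ?_
  rw [mem_closedBall_zero_iff, pi_norm_le_iff_of_nonneg zero_le_one]
  intro i
  have hi : y i * y i ≤ y ⬝ᵥ y :=
    Finset.single_le_sum (f := fun j => y j * y j) (fun j _ => mul_self_nonneg (y j))
      (Finset.mem_univ i)
  exact abs_le_one_iff_mul_self_le_one.2 (hi.trans (hf.dotProduct_lt_one y hy).le)

theorem isCompact_level (hf : KleinBody f) : IsCompact {y | f y = 0} :=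
  Metric.isCompact_of_isClosed_isBounded (isClosed_eq hf.contDiff.continuous continuous_const)
    (hf.isBounded.subset fun _ hy => le_of_eq hy)

theorem isConnected_level (hf : KleinBody f) : IsConnected {y | f y = 0} :=
  hf.posDefHessian.isConnected_level hf.contDiff_two hf.exists_neg (by simp)
    hf.isBounded

theorem setOf_klein_eq_image (hf : KleinBody f) :
    {x | x ∈ H3 ∧ f (klein x) = 0} = fromKlein '' {y | f y = 0} := by
  ext x
  constructor
  · exact fun hx => ⟨klein x, hx.2, fromKlein_klein hx.1⟩
  · rintro ⟨y, hy, rfl⟩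
    have hy1 := hf.dotProduct_lt_one y (le_of_eq hy)
    exact ⟨fromKlein_mem_H3 hy1, (congrArg f (klein_fromKlein hy1)).trans hy⟩

theorem continuousOn_fromKlein_level (hf : KleinBody f) : ContinuousOn fromKlein {y | f y = 0} :=
  continuousOn_fromKlein.mono fun y hy => hf.dotProduct_lt_one y (le_of_eq hy)

theorem lor_conormal_neg (hf : KleinBody f) {p x : Mink} (hp : f (klein p) = 0) (hx : 0 < x 0)
    (hfx : f (klein x) ≤ 0) (hne : klein x ≠ klein p) : lor (conormal f p) x < 0 := by
  have hlt := hf.posDefHessian.fderiv_sub_lt hf.contDiff_two hne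
  rw [lor_conormal, kleinDeriv_klein hx.ne', map_smul, smul_eq_mul]
  exact mul_neg_of_pos_of_neg hx (by linarith)

theorem lor_conormal_self_pos (hf : KleinBody f) {p : Mink} (hp : p ∈ H3)
    (hfp : f (klein p) = 0) : 0 < lor (conormal f p) (conormal f p) := by
  refine lor_self_pos hp.1 (lor_self_conormal f hp.2.ne') fun h => ?_
  obtain ⟨y, hy⟩ := hf.exists_neg
  have hklein : klein (Matrix.vecCons 1 y) = y := by
    simpa using klein_smul_vecCons one_ne_zero y
  have hneg := hf.lor_conormal_neg hfp (x := Matrix.vecCons 1 y) one_pos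
    (by rw [hklein]; exact hy.le) (by rw [hklein]; rintro rfl; exact hy.ne hfp)
  rw [h, lor_zero_left] at hneg
  exact hneg.false

theorem contDiffAt_conormal (hf : KleinBody f) {x : Mink} (hx : x 0 ≠ 0) :
    ContDiffAt ℝ ∞ (conormal f) x := by
  have hklein := contDiffAt_klein hx
  have hfderiv : ContDiffAt ℝ ∞ (fun z => fderiv ℝ f (klein z)) x :=
    (hf.contDiff.fderiv_right (m := ∞) (by simp)).contDiffAt.comp x hklein
  refine contDiffAt_pi.2 fun i => ?_
  cases i using Fin.cases with
  | zero => exact hfderiv.clm_apply hklein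
  | succ i => exact hfderiv.clm_apply contDiffAt_const

theorem contDiffAt_lor_conormal_self (hf : KleinBody f) {x : Mink} (hx : x 0 ≠ 0) :
    ContDiffAt ℝ ∞ (fun z => lor (conormal f z) (conormal f z)) x :=
  (lorL.contDiff.contDiffAt.comp x (hf.contDiffAt_conormal hx)).clm_apply
    (hf.contDiffAt_conormal hx)

theorem contDiffAt_inv_sqrt (hf : KleinBody f) {x : Mink} (hx : x 0 ≠ 0)
    (hpos : 0 < lor (conormal f x) (conormal f x)) :
    ContDiffAt ℝ ∞ (fun z => (√(lor (conormal f z) (conormal f z)))⁻¹) x :=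
  ((hf.contDiffAt_lor_conormal_self hx).sqrt hpos.ne').inv (Real.sqrt_ne_zero'.2 hpos)

/-- The surface in `H3` that bounds a convex body of the Klein model. -/
def surface (hf : KleinBody f) : CompactSurface where
  carrier := {x | x ∈ H3 ∧ f (klein x) = 0}
  normal x := (√(lor (conormal f x) (conormal f x)))⁻¹ • conormal f x
  subset_H3 := fun _ h => h.1
  isCompact := by
    rw [hf.setOf_klein_eq_image]
    exact hf.isCompact_level.image_of_continuousOn hf.continuousOn_fromKlein_level
  isConnected := by
    rw [hf.setOf_klein_eq_image]
    exact hf.isConnected_level.image _ hf.continuousOn_fromKlein_level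
  regular p hp := by
    have hpos := Real.sqrt_pos.2 (hf.lor_conormal_self_pos hp.1 hp.2)
    have hp0 := hp.1.2
    refine ⟨{x | 0 < x 0}, isOpen_lt continuous_const (continuous_apply 0), hp0, f ∘ klein,
      fun x hx => ?_, ?_, (p 0)⁻¹ * √(lor (conormal f p) (conormal f p)),
      mul_ne_zero (inv_pos.2 hp0).ne' hpos.ne', fun v _ => ?_⟩
    · exact (hf.contDiff.contDiffAt.comp x (contDiffAt_klein (ne_of_gt hx))).contDiffWithinAt
    · ext x
      exact ⟨fun hx => ⟨hx.1.1, hx.2, hx.1.2⟩, fun hx => ⟨⟨hx.1, hx.2.2⟩, hx.2.1⟩⟩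
    · have hfderiv := (hf.contDiff.differentiable (by simp) (klein p)).hasFDerivAt.comp p
        (hasFDerivAt_klein hp0.ne')
      rw [hfderiv.fderiv, lor_smul_left, mul_assoc, mul_inv_cancel_left₀ hpos.ne', lor_conormal]
      exact map_smul (fderiv ℝ f (klein p)) _ _
  normal_smooth := by
    have hopen : IsOpen {x : Mink | 0 < x 0} := isOpen_lt continuous_const (continuous_apply 0)
    have hcont : ContinuousOn (fun x => lor (conormal f x) (conormal f x)) {x | 0 < x 0} :=
      fun x hx =>
        (hf.contDiffAt_lor_conormal_self (ne_of_gt hx)).continuousAt.continuousWithinAt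
    refine ⟨_, hcont.isOpen_inter_preimage hopen isOpen_Ioi,
      fun p hp => ⟨hp.1.2, hf.lor_conormal_self_pos hp.1 hp.2⟩, fun x hx => ?_⟩
    have hx0 : x 0 ≠ 0 := ne_of_gt hx.1
    exact ((hf.contDiffAt_inv_sqrt hx0 hx.2).smul
      (hf.contDiffAt_conormal hx0)).contDiffWithinAt
  normal_tangent p hp := by
    rw [lor_smul_right, lor_self_conormal f hp.1.2.ne', mul_zero]
  normal_unit p hp := by
    have hpos := hf.lor_conormal_self_pos hp.1 hp.2
    rw [lor_smul_left, lor_smul_right, ← mul_assoc, ← mul_inv, Real.mul_self_sqrt hpos.le,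
      inv_mul_cancel₀ hpos.ne']

theorem lor_normal (hf : KleinBody f) (p v : Mink) : lor (hf.surface.normal p) v =
    (√(lor (conormal f p) (conormal f p)))⁻¹ * lor (conormal f p) v :=
  lor_smul_left _ _ _

theorem inv_sqrt_pos (hf : KleinBody f) {p : Mink} (hp : p ∈ hf.surface.carrier) :
    0 < (√(lor (conormal f p) (conormal f p)))⁻¹ :=
  inv_pos.2 (Real.sqrt_pos.2 (hf.lor_conormal_self_pos hp.1 hp.2))

theorem lor_normal_eq_zero_iff (hf : KleinBody f) {p : Mink} (hp : p ∈ hf.surface.carrier)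
    (v : Mink) : lor (hf.surface.normal p) v = 0 ↔ lor (conormal f p) v = 0 := by
  rw [lor_normal, mul_eq_zero, or_iff_right (hf.inv_sqrt_pos hp).ne']

theorem supported (hf : KleinBody f) : hf.surface.Supported := by
  intro p hp x hx hne
  rw [lor_normal]
  refine mul_neg_of_pos_of_neg (hf.inv_sqrt_pos hp)
    (hf.lor_conormal_neg hp.2 hx.1.2 hx.2.le fun h => hne ?_)
  rw [← fromKlein_klein hx.1, h, fromKlein_klein hp.1]

theorem fderiv_lor_conormal (hf : KleinBody f) {p v : Mink} (hp : p 0 ≠ 0)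
    (hv : lor (conormal f p) v = 0) :
    fderiv ℝ (fun x => lor (conormal f x) v) p v =
      (p 0)⁻¹ * fderiv ℝ (fderiv ℝ f) (klein p) (kleinDeriv (klein p) v)
        (kleinDeriv (klein p) v) := by
  rw [lor_conormal] at hv
  have hf' := (hf.contDiff_two.fderiv_right (m := 1) (by norm_num)).differentiable (by simp)
    (klein p)
  have hcomp := (hf'.hasFDerivAt.clm_apply
    (((hasFDerivAt_id (klein p)).const_smul (v 0)).const_sub (Fin.tail v))).comp p
      (hasFDerivAt_klein hp)
  have heq : (fun x => lor (conormal f x) v) =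
      (fun y => fderiv ℝ f y (Fin.tail v - (v 0 • id) y)) ∘ klein := by
    ext x
    rw [lor_conormal, kleinDeriv_apply]
    rfl
  rw [heq, hcomp.fderiv]
  simp [← kleinDeriv_apply, hv]

theorem quadraticallyConvex (hf : KleinBody f) : hf.surface.QuadraticallyConvex := by
  refine ⟨hf.supported.strictlyConvex, fun p hp => Or.inr ?_⟩
  rintro v ⟨hpv, hnv⟩ hv
  have hp0 := hp.1.2
  have hpos := hf.lor_conormal_self_pos hp.1 hp.2
  have hscale := (hf.contDiffAt_inv_sqrt hp0.ne' hpos).differentiableAt (by simp)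
  have hconormal := (hf.contDiffAt_conormal hp0.ne').differentiableAt (by simp)
  have hnormal : DifferentiableAt ℝ hf.surface.normal p := hscale.smul hconormal
  have hlor : DifferentiableAt ℝ (fun x => lor (conormal f x) v) p :=
    (lorL.flip v).differentiableAt.comp p hconormal
  rw [hf.lor_normal_eq_zero_iff hp] at hnv
  have hderiv : lor (fderiv ℝ hf.surface.normal p v) v =
      (√(lor (conormal f p) (conormal f p)))⁻¹ * ((p 0)⁻¹ *
        fderiv ℝ (fderiv ℝ f) (klein p) (kleinDeriv (klein p) v) (kleinDeriv (klein p) v)) := by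
    rw [lor_fderiv_left hnormal, ← hf.fderiv_lor_conormal hp0.ne' hnv]
    simp only [lor_normal]
    rw [fderiv_fun_mul hscale hlor, add_apply, smul_apply, smul_apply, hnv, zero_smul, add_zero,
      smul_eq_mul]
  rw [CompactSurface.shape, tanProj, lor_neg_left, lor_add_left, lor_smul_left, hpv, mul_zero,
    add_zero, hderiv, neg_lt_zero]
  exact mul_pos (hf.inv_sqrt_pos hp) (mul_pos (inv_pos.2 hp0)
    (hf.posDefHessian _ _ (kleinDeriv_ne_zero hp.1 hpv hv)))

end KleinBody

/-! ### A convex quartic -/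

section Quartic

open ContinuousLinearMap (proj)

variable {ι κ : Type*} [Fintype ι] [Fintype κ] (ℓ : ι → (κ → ℝ) →L[ℝ] ℝ) (c : κ → ℝ) (C : ℝ)

/-- A sum of fourth powers of affine functions and of a diagonal quadratic form, up to a constant:
a polynomial whose Hessian is visibly positive definite when `c` is positive. -/
def quartic (y : κ → ℝ) : ℝ := ∑ i, (1 + ℓ i y) ^ 4 + ∑ j, c j * y j ^ 2 - C

theorem contDiff_quartic : ContDiff ℝ ∞ (quartic ℓ c C) := by
  unfold quartic
  fun_prop

theorem fderiv_quartic (y : κ → ℝ) : fderiv ℝ (quartic ℓ c C) y =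
    ∑ i, (4 * (1 + ℓ i y) ^ 3) • ℓ i +
      ∑ j, (2 * c j * y j) • proj (R := ℝ) (φ := fun _ => ℝ) j := by
  have hfourth (i : ι) :
      HasFDerivAt (fun z => (1 + ℓ i z) ^ 4) ((4 * (1 + ℓ i y) ^ 3) • ℓ i) y := by
    simpa using ((ℓ i).hasFDerivAt.const_add 1).pow 4
  have hsquare (j : κ) : HasFDerivAt (fun z : κ → ℝ => c j * z j ^ 2)
      ((2 * c j * y j) • proj (R := ℝ) (φ := fun _ => ℝ) j) y := by
    refine (((hasFDerivAt_apply j y).pow 2).const_mul (c j)).congr_fderiv ?_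
    ext v
    simp only [Nat.add_one_sub_one, pow_one, nsmul_eq_mul, Nat.cast_ofNat, smul_apply,
      ContinuousLinearMap.proj_apply, smul_eq_mul]
    ring
  exact (((HasFDerivAt.fun_sum fun i _ => hfourth i).add
    (HasFDerivAt.fun_sum fun j _ => hsquare j)).sub_const C).fderiv

theorem fderiv_quartic_apply (y v : κ → ℝ) : fderiv ℝ (quartic ℓ c C) y v =
    ∑ i, 4 * (1 + ℓ i y) ^ 3 * ℓ i v + ∑ j, 2 * c j * y j * v j := by
  simp [fderiv_quartic]

theorem fderiv_fderiv_quartic_apply (y v : κ → ℝ) :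
    fderiv ℝ (fderiv ℝ (quartic ℓ c C)) y v v =
      ∑ i, 12 * (1 + ℓ i y) ^ 2 * ℓ i v ^ 2 + ∑ j, 2 * c j * v j ^ 2 := by
  have hcube (i : ι) : HasFDerivAt (fun z => (4 * (1 + ℓ i z) ^ 3) • ℓ i)
      (((12 * (1 + ℓ i y) ^ 2) • ℓ i).smulRight (ℓ i)) y := by
    refine HasFDerivAt.smul_const ?_ (ℓ i)
    refine ((((ℓ i).hasFDerivAt.const_add 1).pow 3).const_mul 4).congr_fderiv ?_
    ext v
    simp only [Nat.add_one_sub_one, nsmul_eq_mul, Nat.cast_ofNat, smul_apply, smul_eq_mul]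
    ring
  have hlin (j : κ) : HasFDerivAt
      (fun z : κ → ℝ => (2 * c j * z j) • proj (R := ℝ) (φ := fun _ => ℝ) j)
      (((2 * c j) • proj j).smulRight (proj j)) y :=
    HasFDerivAt.smul_const ((hasFDerivAt_apply (𝕜 := ℝ) j y).const_mul (2 * c j)) (proj j)
  rw [funext (fderiv_quartic ℓ c C), ((HasFDerivAt.fun_sum fun i _ => hcube i).fun_add
    (HasFDerivAt.fun_sum fun j _ => hlin j)).fderiv]
  simp [pow_two, mul_assoc]

theorem posDefHessian_quartic (hc : ∀ j, 0 < c j) : PosDefHessian (quartic ℓ c C) := by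
  intro y v hv
  obtain ⟨j, hj⟩ := Function.ne_iff.1 hv
  rw [fderiv_fderiv_quartic_apply]
  refine add_pos_of_nonneg_of_pos (Finset.sum_nonneg fun i _ => by positivity)
    (Finset.sum_pos' (fun i _ => ?_) ⟨j, Finset.mem_univ j, ?_⟩)
  · have := hc i
    positivity
  · have := hc j
    have hj : v j ≠ 0 := hj
    positivity

end Quartic

/-! ### Chains in homogeneous coordinates -/

theorem unitTangent_inv_sqrt_smul {N : ℝ} (hN : 0 < N) {Q E : Mink} (hQ0 : 0 < Q 0)
    (hQ : lor Q Q = -N) (hQE : lor Q E = 0) (hE : lor E E = N) :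
    UnitTangent ((√N)⁻¹ • Q) ((√N)⁻¹ • E) := by
  have hscale : (√N)⁻¹ * (√N)⁻¹ = N⁻¹ := by rw [← mul_inv, Real.mul_self_sqrt hN.le]
  refine ⟨⟨?_, ?_⟩, ?_, ?_⟩
  · rw [lor_smul_left, lor_smul_right, hQ, ← mul_assoc, hscale, mul_neg, inv_mul_cancel₀ hN.ne']
  · exact mul_pos (inv_pos.2 (Real.sqrt_pos.2 hN)) hQ0
  · rw [lor_smul_left, lor_smul_right, hQE, mul_zero, mul_zero]
  · rw [lor_smul_left, lor_smul_right, hE, ← mul_assoc, hscale, inv_mul_cancel₀ hN.ne']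

theorem PosFrame.smul {x u v w : Mink} (h : PosFrame x u v w) {a b c d : ℝ} (ha : 0 < a)
    (hb : 0 < b) (hc : 0 < c) (hd : 0 < d) : PosFrame (a • x) (b • u) (c • v) (d • w) := by
  have hdet : (Matrix.of ![a • x, b • u, c • v, d • w]).det =
      a * b * c * d * (Matrix.of ![x, u, v, w]).det := by
    simp only [frame_det, Pi.smul_apply, smul_eq_mul]
    ring
  rw [PosFrame, hdet]
  exact mul_pos (by positivity) h

theorem reflect_fromKlein {y : Fin 3 → ℝ} (hy : y ⬝ᵥ y < 1) (x : Mink) :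
    reflect (fromKlein y) x =
      -x - (2 * lor x (Matrix.vecCons 1 y) / (1 - y ⬝ᵥ y)) • Matrix.vecCons 1 y := by
  have hscale : (√(1 - y ⬝ᵥ y))⁻¹ * (√(1 - y ⬝ᵥ y))⁻¹ = (1 - y ⬝ᵥ y)⁻¹ := by
    rw [← mul_inv, Real.mul_self_sqrt (sub_pos.2 hy).le]
  rw [reflect, fromKlein, lor_smul_right, smul_smul, div_eq_mul_inv, ← hscale]
  congr 2
  ring

namespace KleinBody

variable {f : (Fin 3 → ℝ) → ℝ}

theorem fromKlein_mem_touchPoints (hf : KleinBody f) {q e : Mink} (h : UnitTangent q e)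
    {y : Fin 3 → ℝ} (hy : f y = 0) (hq : fderiv ℝ f y (kleinDeriv y q) = 0)
    (he : fderiv ℝ f y (kleinDeriv y e) = 0) :
    fromKlein y ∈ hf.surface.touchPoints h.line := by
  have hy1 := hf.dotProduct_lt_one y hy.le
  have hmem : fromKlein y ∈ hf.surface.carrier :=
    ⟨fromKlein_mem_H3 hy1, by rw [klein_fromKlein hy1, hy]⟩
  rw [← klein_fromKlein hy1, ← lor_conormal, ← hf.lor_normal_eq_zero_iff hmem] at hq he
  rw [h.mem_touchPoints_iff, lor_comm q, lor_comm e]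
  exact ⟨hmem, hq, he⟩

theorem periodicChain (hf : KleinBody f) {n : ℕ} {N : ℝ} (hN : 0 < N) {Q E : ZMod n → Mink}
    {y : ZMod n → Fin 3 → ℝ} {d : ZMod n → ℝ} (hQ0 : ∀ k, 0 < Q k 0)
    (hQ : ∀ k, lor (Q k) (Q k) = -N) (hQE : ∀ k, lor (Q k) (E k) = 0)
    (hE : ∀ k, lor (E k) (E k) = N) (hy : ∀ k, f (y k) = 0)
    (hyQ : ∀ k, fderiv ℝ f (y k) (kleinDeriv (y k) (Q k)) = 0)
    (hyE : ∀ k, fderiv ℝ f (y k) (kleinDeriv (y k) (E k)) = 0)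
    (hfoot : ∀ k, lor (E k) (Matrix.vecCons 1 (y k)) = 0)
    (hframe : ∀ k,
      PosFrame (Q k) (Matrix.vecCons 1 (y (k + 1))) (Matrix.vecCons 1 (y k)) (E k))
    (hbase : ∀ k, Q (k + 1) = reflect (fromKlein (y (k + 1))) (hyperbola (Q k) (E k) (d k)))
    (hvel : ∀ k, E (k + 1) = hyperbola (E k) (Q k) (d k)) :
    PeriodicChain hf.surface (fun k => (√N)⁻¹ • Q k) (fun k => (√N)⁻¹ • E k)
      (fun k => fromKlein (y k)) d where
  unitTangent k := unitTangent_inv_sqrt_smul hN (hQ0 k) (hQ k) (hQE k) (hE k)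
  mem k := hf.fromKlein_mem_touchPoints _ (hy k)
    (by rw [map_smul, map_smul, hyQ, smul_zero]) (by rw [map_smul, map_smul, hyE, smul_zero])
  foot k := by rw [fromKlein, lor_smul_left, lor_smul_right, hfoot, mul_zero, mul_zero]
  frame k := by
    have hscale : 0 < (√N)⁻¹ := inv_pos.2 (Real.sqrt_pos.2 hN)
    have hpos (k : ZMod n) : 0 < (√(1 - y k ⬝ᵥ y k))⁻¹ :=
      inv_pos.2 (Real.sqrt_pos.2 (sub_pos.2 (hf.dotProduct_lt_one _ (hy k).le)))
    exact (hframe k).smul hscale (hpos _) (hpos _) hscale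
  base_succ k := by rw [hyperbola_smul, reflect_smul, hbase]
  vel_succ k := by rw [hyperbola_smul, hvel]

end KleinBody

/-! ### A closed chain of four lines -/

open ContinuousLinearMap (proj) in
/-- The linear parts of the affine functions in the equation of the surface. Permuted by the
rotation by `π` about the third axis, they take the values `±3/4 ± 3/4 ± 1/4` at the points of
tangency. -/
def chainFacet : Fin 4 → (Fin 3 → ℝ) →L[ℝ] ℝ :=
  ![(2 : ℝ) • proj 0 + (30 / 11 : ℝ) • proj 1 + (5 / 4 : ℝ) • proj 2,
    (2 : ℝ) • proj 0 - (30 / 11 : ℝ) • proj 1 - (5 / 4 : ℝ) • proj 2,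
    -(2 : ℝ) • proj 0 + (30 / 11 : ℝ) • proj 1 - (5 / 4 : ℝ) • proj 2,
    -(2 : ℝ) • proj 0 - (30 / 11 : ℝ) • proj 1 + (5 / 4 : ℝ) • proj 2]

/-- The function that defines the surface. Its coefficients are chosen so that the surface passes
through the points `chainTouch k` and is tangent there to the lines of the chain. -/
def chainEquation : (Fin 3 → ℝ) → ℝ := quartic chainFacet ![15, 85 / 121, 945 / 32] (2187 / 64)

theorem chainEquation_apply (y : Fin 3 → ℝ) : chainEquation y =
    (1 + (2 * y 0 + 30 / 11 * y 1 + 5 / 4 * y 2)) ^ 4 +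
    (1 + (2 * y 0 - 30 / 11 * y 1 - 5 / 4 * y 2)) ^ 4 +
    (1 + (-2 * y 0 + 30 / 11 * y 1 - 5 / 4 * y 2)) ^ 4 +
    (1 + (-2 * y 0 - 30 / 11 * y 1 + 5 / 4 * y 2)) ^ 4 +
    15 * y 0 ^ 2 + 85 / 121 * y 1 ^ 2 + 945 / 32 * y 2 ^ 2 - 2187 / 64 := by
  rw [chainEquation, quartic, Fin.sum_univ_four, Fin.sum_univ_three, ← add_assoc, ← add_assoc]
  rfl

theorem kleinBody_chainEquation : KleinBody chainEquation where
  contDiff := contDiff_quartic _ _ _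
  posDefHessian := posDefHessian_quartic _ _ _ fun j => by fin_cases j <;> norm_num
  exists_neg := ⟨0, by norm_num [chainEquation_apply]⟩
  dotProduct_lt_one y hy := by
    -- In the sum of these bounds over the four fourth powers the terms linear in `y` cancel.
    have hpow (t : ℝ) : 4 * t ^ 2 - 4 ≤ t ^ 4 := by linarith [sq_nonneg (t ^ 2 - 2)]
    rw [chainEquation_apply] at hy
    have := hpow (1 + (2 * y 0 + 30 / 11 * y 1 + 5 / 4 * y 2))
    have := hpow (1 + (2 * y 0 - 30 / 11 * y 1 - 5 / 4 * y 2))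
    have := hpow (1 + (-2 * y 0 + 30 / 11 * y 1 - 5 / 4 * y 2))
    have := hpow (1 + (-2 * y 0 - 30 / 11 * y 1 + 5 / 4 * y 2))
    have hdot : y ⬝ᵥ y = y 0 ^ 2 + y 1 ^ 2 + y 2 ^ 2 := by
      simp only [dotProduct, Fin.sum_univ_three]
      ring
    have := sq_nonneg (y 0)
    have := sq_nonneg (y 1)
    have := sq_nonneg (y 2)
    linarith

theorem fderiv_chainEquation_apply (y v : Fin 3 → ℝ) : fderiv ℝ chainEquation y v =
    4 * (1 + (2 * y 0 + 30 / 11 * y 1 + 5 / 4 * y 2)) ^ 3 *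
      (2 * v 0 + 30 / 11 * v 1 + 5 / 4 * v 2) +
    4 * (1 + (2 * y 0 - 30 / 11 * y 1 - 5 / 4 * y 2)) ^ 3 *
      (2 * v 0 - 30 / 11 * v 1 - 5 / 4 * v 2) +
    4 * (1 + (-2 * y 0 + 30 / 11 * y 1 - 5 / 4 * y 2)) ^ 3 *
      (-2 * v 0 + 30 / 11 * v 1 - 5 / 4 * v 2) +
    4 * (1 + (-2 * y 0 - 30 / 11 * y 1 + 5 / 4 * y 2)) ^ 3 *
      (-2 * v 0 - 30 / 11 * v 1 + 5 / 4 * v 2) +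
    2 * 15 * y 0 * v 0 + 2 * (85 / 121) * y 1 * v 1 + 2 * (945 / 32) * y 2 * v 2 := by
  rw [chainEquation, fderiv_quartic_apply, Fin.sum_univ_four, Fin.sum_univ_three, ← add_assoc,
    ← add_assoc]
  rfl

/-- Homogeneous coordinates of the point of the `k`-th line nearest to `chainTouch k`. -/
def chainBase : ZMod 4 → Mink :=
  ![![135, 90, -(22 / 5), 121 / 5], ![121, 6, 66, -27],
    ![135, -90, 22 / 5, 121 / 5], ![121, -6, -66, -27]]

/-- The direction of the `k`-th line at `chainBase k`, on the same scale. -/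
def chainVel : ZMod 4 → Mink :=
  ![![33, 22, -18, 99], ![-33, -22, -18, 99], ![33, -22, 18, 99], ![-33, 22, 18, 99]]

/-- The left point of tangency of the `k`-th line, in the Klein model. -/
def chainTouch : ZMod 4 → Fin 3 → ℝ :=
  ![![3 / 8, -(11 / 40), 1 / 5], ![3 / 8, 11 / 40, -(1 / 5)],
    ![-(3 / 8), 11 / 40, 1 / 5], ![-(3 / 8), -(11 / 40), -(1 / 5)]]

/-- The signed distance along the `k`-th line. -/
def chainDist : ZMod 4 → ℝ :=
  ![-Real.arsinh (495 / 952), Real.arsinh (33 / 56),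
    -Real.arsinh (495 / 952), Real.arsinh (33 / 56)]

theorem vec_add_one {α : Type*} (a b c d : α) (k : ZMod 4) :
    (![a, b, c, d] : ZMod 4 → α) (k + 1 : ZMod 4) = (![b, c, d, a] : ZMod 4 → α) k := by
  fin_cases k <;> rfl

theorem cosh_chainDist (k : ZMod 4) : Real.cosh (chainDist k) =
    (![1073 / 952, 65 / 56, 1073 / 952, 65 / 56] : ZMod 4 → ℝ) k := by
  have heven : √(1 + (495 / 952) ^ 2 : ℝ) = 1073 / 952 := by
    rw [Real.sqrt_eq_iff_mul_self_eq_of_pos] <;> norm_num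
  have hodd : √(1 + (33 / 56) ^ 2 : ℝ) = 65 / 56 := by
    rw [Real.sqrt_eq_iff_mul_self_eq_of_pos] <;> norm_num
  fin_cases k <;> simp [chainDist, Real.cosh_arsinh, heven, hodd]

theorem sinh_chainDist (k : ZMod 4) : Real.sinh (chainDist k) =
    (![-(495 / 952), 33 / 56, -(495 / 952), 33 / 56] : ZMod 4 → ℝ) k := by
  fin_cases k <;> simp [chainDist]

theorem chainTouch_injective : Function.Injective chainTouch := by
  intro k l h
  fin_cases k <;> fin_cases l <;> first | rfl | norm_num [chainTouch] at h

theorem kleinDeriv_vec (a b c a₀ a₁ a₂ a₃ : ℝ) :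
    kleinDeriv ![a, b, c] ![a₀, a₁, a₂, a₃] = ![a₁ - a₀ * a, a₂ - a₀ * b, a₃ - a₀ * c] := by
  rw [kleinDeriv_apply]
  ext i
  fin_cases i <;> rfl

theorem chainVel_add_one (k : ZMod 4) :
    chainVel (k + 1) = hyperbola (chainVel k) (chainBase k) (chainDist k) := by
  rw [hyperbola, cosh_chainDist, sinh_chainDist, chainVel, vec_add_one]
  fin_cases k <;> norm_num [chainBase]

theorem chainEquation_chainTouch (k : ZMod 4) : chainEquation (chainTouch k) = 0 := by
  rw [chainEquation_apply]
  fin_cases k <;> norm_num [chainTouch, Matrix.cons_val_two]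

theorem dotProduct_chainTouch_lt_one (k : ZMod 4) : chainTouch k ⬝ᵥ chainTouch k < 1 :=
  kleinBody_chainEquation.dotProduct_lt_one _ (chainEquation_chainTouch k).le

theorem chainBase_add_one (k : ZMod 4) : chainBase (k + 1) =
    reflect (fromKlein (chainTouch (k + 1)))
      (hyperbola (chainBase k) (chainVel k) (chainDist k)) := by
  rw [reflect_fromKlein (dotProduct_chainTouch_lt_one _), hyperbola, cosh_chainDist,
    sinh_chainDist, chainBase, chainTouch, vec_add_one, vec_add_one]
  fin_cases k <;> norm_num [chainVel, lor, eq_iff_true_of_subsingleton, Matrix.cons_val_two,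
    Matrix.cons_val_three]

theorem posFrame_chain (k : ZMod 4) :
    PosFrame (chainBase k) (Matrix.vecCons 1 (chainTouch (k + 1)))
      (Matrix.vecCons 1 (chainTouch k)) (chainVel k) := by
  rw [PosFrame, frame_det, chainTouch, vec_add_one]
  fin_cases k <;> norm_num [chainBase, chainVel, Matrix.cons_val_two, Matrix.cons_val_three]

theorem periodicChain_chainTouch : PeriodicChain kleinBody_chainEquation.surface
    (fun k => (√9520)⁻¹ • chainBase k) (fun k => (√9520)⁻¹ • chainVel k)
    (fun k => fromKlein (chainTouch k)) chainDist := by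
  refine kleinBody_chainEquation.periodicChain (by norm_num) ?_ ?_ ?_ ?_ chainEquation_chainTouch
    ?_ ?_ ?_ posFrame_chain chainBase_add_one chainVel_add_one <;> intro k
  · fin_cases k <;> norm_num [chainBase]
  · fin_cases k <;> norm_num [chainBase, lor, Matrix.cons_val_two, Matrix.cons_val_three]
  · fin_cases k <;> norm_num [chainBase, chainVel, lor, Matrix.cons_val_two, Matrix.cons_val_three]
  · fin_cases k <;> norm_num [chainVel, lor, Matrix.cons_val_two, Matrix.cons_val_three]
  · rw [fderiv_chainEquation_apply]
    fin_cases k <;> norm_num [chainBase, chainTouch, kleinDeriv_vec, Matrix.cons_val_two]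
  · rw [fderiv_chainEquation_apply]
    fin_cases k <;> norm_num [chainVel, chainTouch, kleinDeriv_vec, Matrix.cons_val_two]
  · fin_cases k <;> norm_num [chainVel, chainTouch, lor, Matrix.cons_val_two, Matrix.cons_val_three]

theorem sum_chainDist_ne_zero : ∑ k, chainDist k ≠ 0 := by
  have hlt : Real.arsinh (495 / 952) < Real.arsinh (33 / 56) :=
    Real.arsinh_lt_arsinh.2 (by norm_num)
  have hsum : ∑ k, chainDist k = -Real.arsinh (495 / 952) + Real.arsinh (33 / 56) +
      -Real.arsinh (495 / 952) + Real.arsinh (33 / 56) := Fin.sum_univ_four chainDist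
  linarith

theorem injective_fromKlein_chainTouch : Function.Injective fun k => fromKlein (chainTouch k) := by
  intro k l h
  rw [← chainTouch_injective.eq_iff, ← klein_fromKlein (dotProduct_chainTouch_lt_one k),
    ← klein_fromKlein (dotProduct_chainTouch_lt_one l)]
  exact congrArg klein h

end OuterBilliard

end

theorem mainTheorem7 :
    ∃ S : OuterBilliard.CompactSurface, S.QuadraticallyConvex ∧
      ∃ ℓ : S.Table,
        Function.minimalPeriod (OuterBilliard.outerBilliard S) ℓ = 4 ∧
        ∃ h : ℝ, OuterBilliard.IsHolonomy S ℓ h ∧ h ≠ 0 := by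
  have hC := OuterBilliard.periodicChain_chainTouch
  have hp := OuterBilliard.injective_fromKlein_chainTouch
  have hS := OuterBilliard.kleinBody_chainEquation.supported
  exact ⟨OuterBilliard.kleinBody_chainEquation.surface,
    OuterBilliard.kleinBody_chainEquation.quadraticallyConvex, hC.table hS 0,
    hC.minimalPeriod_table_zero hS hp, _, hC.isHolonomy hS hp, OuterBilliard.sum_chainDist_ne_zero⟩
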